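/- For a set $C\subset\mathbb{R}^n$, let the psd rank $\operatorname{rank}_{\mathrm{psd}}(C)\in\mathbb{N}\cup\{\infty\}$ be the smallest positive integer $k$ such that $C=\pi(\mathcal{S}^k_+\cap L)$ for some affine subspace $L$ of the space of real $k\times k$ matrices and some linear map $\pi$ from that space to $\mathbb{R}^n$, where $\mathcal{S}^k_+$ is the cone of real symmetric positive semidefinite $k\times k$ matrices (and $\infty$ if there is no such $k$). A $d$-dimensional polytope $P$ is psd-minimal if $\operatorname{rank}_{\mathrm{psd}}(P)=d+1$. Two polytopes are combinatorially equivalent if there are bijections between their vertices and between their facets that preserve and reflect the vertex-facet incidences. The dual (polar) of a polytope $Q\subset\mathbb{R}^3$ with the origin in its interior is $Q^\circ=\{y\in\mathbb{R}^3:\langle x,y\rangle\le 1\text{ for all }x\in Q\}$. Every psd-minimal $3$-dimensional polytope $P\subset\mathbb{R}^n$ is combinatorially equivalent to $Q$ or to $Q^\circ$ for one of the following four polytopes $Q\subset\mathbb{R}^3$: the simplex $\operatorname{conv}\{e_1,e_2,e_3,-e_1-e_2-e_3\}$, the quadrilateral pyramid $\operatorname{conv}\{(\pm1,\pm1,-1),(0,0,1)\}$,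 the bisimplex (bipyramid over a triangle) $\operatorname{conv}\{e_1,e_2,-e_1-e_2,\pm e_3\}$, and the octahedron $\operatorname{conv}\{\pm e_1,\pm e_2,\pm e_3\}$. -/

import Mathlib

namespace PsdMin

/-- A (convex) polytope: the convex hull of finitely many points. -/
def IsPolytope {n : ℕ} (P : Set (EuclideanSpace ℝ (Fin n))) : Prop :=
  ∃ s : Set (EuclideanSpace ℝ (Fin n)), s.Finite ∧ P = convexHull ℝ s

/-- The dimension of a (nonempty) set: the dimension of its affine hull. -/
noncomputable def dim {n : ℕ} (P : Set (EuclideanSpace ℝ (Fin n))) : ℕ :=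
  Module.finrank ℝ (vectorSpan ℝ P)

/-- The vertices of a polytope are its extreme points. -/
def vertices {n : ℕ} (P : Set (EuclideanSpace ℝ (Fin n))) : Set (EuclideanSpace ℝ (Fin n)) :=
  P.extremePoints ℝ

/-- The facets of a polytope: its nonempty (exposed) faces of codimension one. -/
def facets {n : ℕ} (P : Set (EuclideanSpace ℝ (Fin n))) :
    Set (Set (EuclideanSpace ℝ (Fin n))) :=
  {F | IsExposed ℝ P F ∧ F.Nonempty ∧ dim F + 1 = dim P}

/-- Two polytopes are combinatorially equivalent if they have the same vertex-facet incidence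
structure. -/
def CombEquiv {m n : ℕ} (P : Set (EuclideanSpace ℝ (Fin m)))
    (Q : Set (EuclideanSpace ℝ (Fin n))) : Prop :=
  ∃ (φ : vertices P ≃ vertices Q) (ψ : facets P ≃ facets Q),
    ∀ (v : vertices P) (F : facets P), v.1 ∈ F.1 ↔ (φ v).1 ∈ (ψ F).1

/-- `C` is the image under a linear map of an affine slice of the cone of real symmetric positive
semidefinite `k × k` matrices. (`Matrix.PosSemidef` includes symmetry.) -/
def HasPsdLift {n : ℕ} (k : ℕ) (C : Set (EuclideanSpace ℝ (Fin n))) : Prop :=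
  ∃ (L : AffineSubspace ℝ (Matrix (Fin k) (Fin k) ℝ))
    (π : Matrix (Fin k) (Fin k) ℝ →ₗ[ℝ] EuclideanSpace ℝ (Fin n)),
    C = π '' {X | X.PosSemidef ∧ X ∈ L}

/-- The psd rank: the smallest positive `k` such that `C` has a psd lift of size `k`, and `∞` if
there is none. -/
noncomputable def psdRank {n : ℕ} (C : Set (EuclideanSpace ℝ (Fin n))) : ℕ∞ :=
  ⨅ (k : ℕ) (_ : 1 ≤ k ∧ HasPsdLift k C), (k : ℕ∞)

/-- A `d`-dimensional polytope is psd-minimal if its psd rank is `d + 1`. -/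
def IsPsdMinimal {n : ℕ} (P : Set (EuclideanSpace ℝ (Fin n))) : Prop :=
  psdRank P = (dim P : ℕ∞) + 1

/-- The polar (dual) of a convex body that contains the origin in its interior. -/
def polarBody {n : ℕ} (C : Set (EuclideanSpace ℝ (Fin n))) : Set (EuclideanSpace ℝ (Fin n)) :=
  {y | ∀ x ∈ C, inner ℝ x y ≤ 1}

/-- A `3`-simplex (tetrahedron) with the origin in its interior. -/
noncomputable def simplex : Set (EuclideanSpace ℝ (Fin 3)) :=
  convexHull ℝ {!₂[1, 0, 0], !₂[0, 1, 0], !₂[0, 0, 1], !₂[-1, -1, -1]}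

/-- A quadrilateral pyramid (square base, apex above) with the origin in its interior. -/
noncomputable def quadPyramid : Set (EuclideanSpace ℝ (Fin 3)) :=
  convexHull ℝ {!₂[1, 1, -1], !₂[-1, 1, -1], !₂[-1, -1, -1], !₂[1, -1, -1], !₂[0, 0, 1]}

/-- A bisimplex (bipyramid over a triangle) with the origin in its interior. -/
noncomputable def bisimplex : Set (EuclideanSpace ℝ (Fin 3)) :=
  convexHull ℝ {!₂[1, 0, 0], !₂[0, 1, 0], !₂[-1, -1, 0], !₂[0, 0, 1], !₂[0, 0, -1]}

/-- The octahedron, i.e. the three-dimensional crosspolytope. -/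
noncomputable def octahedron : Set (EuclideanSpace ℝ (Fin 3)) :=
  convexHull ℝ {!₂[1, 0, 0], !₂[-1, 0, 0], !₂[0, 1, 0], !₂[0, -1, 0], !₂[0, 0, 1], !₂[0, 0, -1]}

end PsdMin

open Matrix

namespace PsdMin

/-! A psd lift of size four forces the slack matrix of `P` to have an entrywise square root that
also factors through `ℝ⁴` (`hasSqrt_of_hasPsdLift`). Along a chain vertex, edge, facet, polytope,
the kernels of matrices taken over these faces shrink strictly, so their dimensions are 3, 2, 1, 0.
Hence the matrix over a vertex is a rank-one square `x xᵀ`, a facet inequality is on the slice a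
multiple of `X ↦ yᵀ X y`, and the slack is `(x ⬝ᵥ y) ^ 2`.

The slack matrix and its square root have the same zeros, so a linear-algebra identity that uses
only the zero pattern holds for both. An identity `α = β + γ` in entries of the root comes with `α²
= β² + γ²` for the slacks, hence `βγ = 0`, which is impossible when all these entries are nonzero.
Two such identities suffice: a facet with a fourth vertex has only vertices of degree three
(`facet_of_fourth_vertex`), and no facet has five vertices (`facet_cases`). All this is self-dual,
so vertices have degree three or four, and the facets at a vertex of degree four are triangles.

The rest is combinatorics. If all facets are triangles and all degrees are three, `P` is a simplex.
Around a vertex of degree four, the facets behind its link close up to a pyramid, a bisimplex or an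
octahedron (`hasTable_of_degree_four`); a quadrilateral facet gives the duals. A local list of
vertices and facets is complete because the vertex graph is connected (`bijective_of_table`). The
same principle computes the face structure of the explicit polytopes. -/

/-! ### Triangular systems and coordinates in a hyperplane -/

/-- The pairings form a triangular matrix with nonzero diagonal, so the `g j` are a basis. This is
how vector identities are proved below: both sides are tested on four functionals. -/
theorem eq_zero_of_triangular {q g : Fin 4 → Fin 4 → ℝ} (hd : ∀ i, q i ⬝ᵥ g i ≠ 0)
    (hu : ∀ i j, i < j → q i ⬝ᵥ g j = 0) {x : Fin 4 → ℝ} (hx : ∀ j, x ⬝ᵥ g j = 0) : x = 0 := by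
  have hdet : (Matrix.of q * (Matrix.of g)ᵀ).det ≠ 0 := by
    rw [Matrix.det_of_isLowerTriangular]
    · exact Finset.prod_ne_zero_iff.mpr fun i _ => hd i
    · intro i j hij
      exact hu i j hij
  rw [Matrix.det_mul, Matrix.det_transpose] at hdet
  refine Matrix.eq_zero_of_mulVec_eq_zero (right_ne_zero_of_mul hdet) ?_
  funext j
  rw [Pi.zero_apply, ← hx j, dotProduct_comm]
  rfl

/-- Coordinates, in a hyperplane, with respect to three vectors that are triangular against
a system of functionals. -/
theorem exists_coords {v a b u K B A G x : Fin 4 → ℝ} (vK : v ⬝ᵥ K ≠ 0) (vB : v ⬝ᵥ B = 0)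
    (vA : v ⬝ᵥ A = 0) (vG : v ⬝ᵥ G = 0) (aB : a ⬝ᵥ B ≠ 0) (aA : a ⬝ᵥ A = 0) (aG : a ⬝ᵥ G = 0)
    (bA : b ⬝ᵥ A ≠ 0) (bB : b ⬝ᵥ B = 0) (bG : b ⬝ᵥ G = 0) (uG : u ⬝ᵥ G ≠ 0)
    (xG : x ⬝ᵥ G = 0) :
    ∃ c : ℝ, x = c • v + (x ⬝ᵥ B / a ⬝ᵥ B) • a + (x ⬝ᵥ A / b ⬝ᵥ A) • b := by
  set s := x ⬝ᵥ B / a ⬝ᵥ B with hs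
  set t := x ⬝ᵥ A / b ⬝ᵥ A with ht
  refine ⟨(x ⬝ᵥ K - s * (a ⬝ᵥ K) - t * (b ⬝ᵥ K)) / v ⬝ᵥ K, ?_⟩
  rw [← sub_eq_zero]
  apply eq_zero_of_triangular (q := ![v, a, b, u]) (g := ![K, B, A, G])
  · simp [Fin.forall_fin_succ, *]
  · simp [Fin.forall_fin_succ, *]
  · simp only [Fin.forall_fin_succ, sub_dotProduct, add_dotProduct, smul_dotProduct, smul_eq_mul]
    simp only [hs, ht]
    simp [vB, vA, vG, aA, aG, bB, bG, xG, aB, bA]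
    field_simp
    ring

/-! ### Flags and self-dual representations of polytopes -/

/-- `a`, `b` are the neighbours of the vertex `v` in the facet `G`, and `A`, `B` the facets that
meet `G` in the corresponding edges. -/
structure IsFlag {V F : Type*} (I : V → F → Prop) (v : V) (G : F) (a b : V) (A B : F) : Prop where
  vG : I v G
  aG : I a G
  bG : I b G
  vA : I v A
  vB : I v B
  av : a ≠ v
  bv : b ≠ v
  ab : a ≠ b
  AG : A ≠ G
  BG : B ≠ G
  AB : A ≠ B
  inc_iff : ∀ w H, I w G → I v H → (I w H ↔ w = v ∨ H = G ∨ (w = a ∧ H = A) ∨ (w = b ∧ H = B))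

namespace IsFlag
variable {V F : Type*} {I : V → F → Prop} {v : V} {G : F} {a b : V} {A B : F}

theorem aA (h : IsFlag I v G a b A B) : I a A := by simp [h.inc_iff a A h.aG h.vA]
theorem bB (h : IsFlag I v G a b A B) : I b B := by simp [h.inc_iff b B h.bG h.vB]
theorem aB (h : IsFlag I v G a b A B) : ¬ I a B := by
  simp [h.inc_iff a B h.aG h.vB, h.av, h.BG, h.AB.symm, h.ab]
theorem bA (h : IsFlag I v G a b A B) : ¬ I b A := by
  simp [h.inc_iff b A h.bG h.vA, h.bv, h.AG, h.AB, h.ab.symm]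

theorem swap (h : IsFlag I v G a b A B) : IsFlag I v G b a B A where
  vG := h.vG
  aG := h.bG
  bG := h.aG
  vA := h.vB
  vB := h.vA
  av := h.bv
  bv := h.av
  ab := h.ab.symm
  AG := h.BG
  BG := h.AG
  AB := h.AB.symm
  inc_iff w H hw hH := by rw [h.inc_iff w H hw hH]; tauto

/-- The condition `inc_iff` treats the vertices of `G` and the facets at `v` symmetrically, so
reversing incidence preserves flags. -/
theorem dual (h : IsFlag I v G a b A B) : IsFlag (fun G v => I v G) G v A B a b where
  vG := h.vG
  aG := h.vA
  bG := h.vB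
  vA := h.aG
  vB := h.bG
  av := h.AG
  bv := h.BG
  ab := h.AB
  AG := h.av
  BG := h.bv
  AB := h.ab
  inc_iff H w hH hw := by rw [h.inc_iff w H hw hH]; tauto

theorem eq_or_eq (h : IsFlag I v G a b A B) {w : V} {H : F} (wG : I w G) (vH : I v H) (wH : I w H)
    (wv : w ≠ v) (HG : H ≠ G) : (w = a ∧ H = A) ∨ (w = b ∧ H = B) := by
  have := (h.inc_iff w H wG vH).1 wH
  tauto

end IsFlag

/-- Vertices and facets of a three-dimensional polytope, represented by vectors `p v` and
functionals `f G` in homogeneous coordinates, with the local structure of its flags. -/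
structure PolyRep (V F : Type*) where
  I : V → F → Prop
  p : V → Fin 4 → ℝ
  f : F → Fin 4 → ℝ
  nonneg : ∀ v G, 0 ≤ p v ⬝ᵥ f G
  zero_iff : ∀ v G, p v ⬝ᵥ f G = 0 ↔ I v G
  flag : ∀ v G, I v G → ∃ a b A B, IsFlag I v G a b A B
  exists_facet : ∀ v, ∃ G, I v G
  exists_vertex : ∀ G, ∃ v, I v G

namespace PolyRep
variable {V F : Type*}

/-- The polar representation. -/
def dual (R : PolyRep V F) : PolyRep F V where
  I G v := R.I v G
  p := R.f
  f := R.p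
  nonneg G v := by rw [dotProduct_comm]; exact R.nonneg v G
  zero_iff G v := by rw [dotProduct_comm]; exact R.zero_iff v G
  flag G v h := by
    obtain ⟨a, b, A, B, hf⟩ := R.flag v G h
    exact ⟨A, B, a, b, hf.dual⟩
  exists_facet := R.exists_vertex
  exists_vertex := R.exists_facet

theorem zero (R : PolyRep V F) {v : V} {G : F} (h : R.I v G) : R.p v ⬝ᵥ R.f G = 0 :=
  (R.zero_iff v G).2 h

theorem ne_zero (R : PolyRep V F) {v : V} {G : F} (h : ¬ R.I v G) : R.p v ⬝ᵥ R.f G ≠ 0 :=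
  fun h0 => h ((R.zero_iff v G).1 h0)

theorem pos (R : PolyRep V F) {v : V} {G : F} (h : ¬ R.I v G) : 0 < R.p v ⬝ᵥ R.f G :=
  lt_of_le_of_ne (R.nonneg v G) (R.ne_zero h).symm

/-- In the flag at `a` in `G`, a further common vertex of `G` and `H` is the neighbour whose edge
lies in `H`. Since `A ≠ B`, there is only one such neighbour. -/
theorem two (R : PolyRep V F) {G H : F} (hGH : G ≠ H) {a b c : V} (hab : a ≠ b)
    (aG : R.I a G) (bG : R.I b G) (cG : R.I c G) (aH : R.I a H) (bH : R.I b H) (cH : R.I c H) :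
    c = a ∨ c = b := by
  obtain ⟨a', b', A, B, hf⟩ := R.flag a G aG
  by_contra! hc
  have h1 := hf.eq_or_eq bG aH bH hab.symm hGH.symm
  have h2 := hf.eq_or_eq cG aH cH hc.1 hGH.symm
  have := hf.AB
  grind

/-- Seen from a neighbour `a` of `v` in `G`, one of the two edges of `G` leads to `v`; the facet
across the other edge misses `v`. -/
theorem exists_not_mem (R : PolyRep V F) (v : V) : ∃ K, ¬ R.I v K := by
  obtain ⟨G, hG⟩ := R.exists_facet v
  obtain ⟨a, b, A, B, hf⟩ := R.flag v G hG
  obtain ⟨a1, b1, A1, B1, h1⟩ := R.flag a G hf.aG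
  rcases h1.eq_or_eq hG hf.aA hf.vA hf.av.symm hf.AG with ⟨rfl, _⟩ | ⟨rfl, _⟩
  · exact ⟨B1, h1.aB⟩
  · exact ⟨A1, h1.bA⟩

/-- Only the zero pattern of `p` and `f` enters. The lemma thus applies both to the slack
factorisation and to its square root, which is what makes the two comparable. -/
theorem exists_coords_of_flag (R : PolyRep V F) {v G a b A B}
    (hf : IsFlag R.I v G a b A B) (p f : _ → Fin 4 → ℝ)
    (hpf : ∀ v G, p v ⬝ᵥ f G = 0 ↔ R.I v G) {x : Fin 4 → ℝ} (hx : x ⬝ᵥ f G = 0) :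
    ∃ c : ℝ, x = c • p v + (x ⬝ᵥ f B / p a ⬝ᵥ f B) • p a + (x ⬝ᵥ f A / p b ⬝ᵥ f A) • p b := by
  obtain ⟨K, hK⟩ := R.exists_not_mem v
  obtain ⟨u, hu⟩ := R.dual.exists_not_mem G
  have hu : ¬ R.I u G := hu
  apply exists_coords (K := f K) (G := f G) (u := p u) <;> first | assumption | simp only [ne_eq, hpf]
  exacts [hK, hf.vB, hf.vA, hf.vG, hf.aB, hf.aA, hf.aG, hf.bA, hf.bB, hf.bG, hu]

/-! ### Connectivity of the vertex graph -/

/-- `w` is a neighbour of `v` in the facet `G`. -/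
def Nbr (R : PolyRep V F) (G : F) (v w : V) : Prop :=
  w ≠ v ∧ R.I v G ∧ R.I w G ∧ ∃ H, H ≠ G ∧ R.I v H ∧ R.I w H

theorem nbr_iff (R : PolyRep V F) {v G a b A B} (hf : IsFlag R.I v G a b A B) (w : V) :
    R.Nbr G v w ↔ w = a ∨ w = b := by
  constructor
  · rintro ⟨wv, -, wG, H, HG, vH, wH⟩
    have := hf.eq_or_eq wG vH wH wv HG
    tauto
  · rintro (rfl | rfl)
    · exact ⟨hf.av, hf.vG, hf.aG, A, hf.AG, hf.vA, hf.aA⟩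
    · exact ⟨hf.bv, hf.vG, hf.bG, B, hf.BG, hf.vB, hf.bB⟩

/-- A positive functional used to normalise the points `p v`. -/
noncomputable def weight [Fintype F] (R : PolyRep V F) : Fin 4 → ℝ := ∑ K, R.f K

theorem weight_pos [Fintype F] (R : PolyRep V F) (v : V) : 0 < R.p v ⬝ᵥ R.weight := by
  obtain ⟨K, hK⟩ := R.exists_not_mem v
  rw [weight, dotProduct_sum]
  exact Finset.sum_pos' (fun G _ => R.nonneg v G) ⟨K, Finset.mem_univ _, R.pos hK⟩

/-- The point `u` minimises the normalised distance to `H`, and `g` is the level functional through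
`u`. A vertex of `H` has distance zero; if it is not below the level of `u`, then `u` is at distance
zero too. -/
theorem exists_minimizer [Finite V] [Fintype F] (R : PolyRep V F) (H : F) (C : Set V)
    (hC : C.Nonempty) : ∃ u ∈ C, ∃ g : Fin 4 → ℝ, R.p u ⬝ᵥ g = 0 ∧ (∀ v ∈ C, 0 ≤ R.p v ⬝ᵥ g) ∧
      ∀ w, R.I w H → 0 ≤ R.p w ⬝ᵥ g → R.I u H := by
  obtain ⟨u, hu, hmin⟩ := Set.exists_min_image C
    (fun v => (R.p v ⬝ᵥ R.f H) / (R.p v ⬝ᵥ R.weight)) (Set.toFinite C) hC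
  refine ⟨u, hu, R.f H - ((R.p u ⬝ᵥ R.f H) / (R.p u ⬝ᵥ R.weight)) • R.weight, ?_, ?_, ?_⟩
  · have := R.weight_pos u
    simp only [dotProduct_sub, dotProduct_smul, smul_eq_mul]
    field_simp
    ring
  · intro v hv
    have h1 := hmin v hv
    rw [le_div_iff₀ (R.weight_pos v)] at h1
    simpa only [dotProduct_sub, dotProduct_smul, smul_eq_mul, sub_nonneg] using h1
  · intro w hw h
    simp only [dotProduct_sub, dotProduct_smul, smul_eq_mul, sub_nonneg, R.zero hw] at h
    have h2 : (R.p u ⬝ᵥ R.f H) / (R.p u ⬝ᵥ R.weight) ≤ 0 :=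
      nonpos_of_mul_nonpos_left h (R.weight_pos w)
    have h3 : R.p u ⬝ᵥ R.f H ≤ 0 := by
      by_contra! h4
      exact absurd h2 (not_le.mpr (div_pos h4 (R.weight_pos u)))
    exact (R.zero_iff u H).1 (le_antisymm h3 (R.nonneg u H))

/-- The simplex method inside `G`. For a missing vertex `w`, take a facet `H` through an edge of `G`
at `w` and the vertex `u` of `C` in `G` closest to `H`. Its neighbours are not closer, and `G` lies
in the cone they span at `u`, so `u` lies in `H`. Then `u` and `w` are neighbours. -/
theorem facet_connected [Finite V] [Finite F] (R : PolyRep V F) {G : F} (C : Set V)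
    (hne : ∃ u ∈ C, R.I u G) (hC : ∀ u ∈ C, ∀ w, R.Nbr G u w → w ∈ C) :
    ∀ w, R.I w G → w ∈ C := by
  have := Fintype.ofFinite F
  intro w wG
  by_contra hw
  obtain ⟨_, _, H, _, hfw⟩ := R.flag w G wG
  obtain ⟨u, ⟨huC, huG⟩, g, gu, gC, gH⟩ := R.exists_minimizer H {v | v ∈ C ∧ R.I v G} hne
  obtain ⟨a, b, A, B, hf⟩ := R.flag u G huG
  have haC := hC u huC a ((R.nbr_iff hf a).2 (Or.inl rfl))
  have hbC := hC u huC b ((R.nbr_iff hf b).2 (Or.inr rfl))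
  have uH : R.I u H := by
    apply gH w hfw.vA
    obtain ⟨c, hc⟩ := R.exists_coords_of_flag hf R.p R.f R.zero_iff (R.zero wG)
    rw [hc]
    simp only [add_dotProduct, smul_dotProduct, gu, smul_eq_mul, mul_zero, zero_add]
    have := gC a ⟨haC, hf.aG⟩
    have := gC b ⟨hbC, hf.bG⟩
    have := R.nonneg
    have := this w A
    have := R.nonneg w B
    have := R.nonneg a B
    have := R.nonneg b A
    positivity
  have : w ≠ u := fun h => hw (h ▸ huC)
  exact hw (hC u huC w ⟨this, huG, wG, H, hfw.AG, uH, hfw.vA⟩)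

/-- A functional that is nonnegative on the neighbours of `u` and zero at `u` becomes nonnegative
when a point of the cone at `u` is moved to the boundary of this cone. -/
theorem exists_exit [Finite F] (R : PolyRep V F) {u : V} {g x d : Fin 4 → ℝ}
    (gu : R.p u ⬝ᵥ g = 0) (hg : ∀ G w, R.Nbr G u w → 0 ≤ R.p w ⬝ᵥ g)
    (hx : ∀ K, R.I u K → 0 ≤ x ⬝ᵥ R.f K) (hd : ∃ K, R.I u K ∧ d ⬝ᵥ R.f K < 0) :
    ∃ t : ℝ, 0 ≤ t ∧ 0 ≤ (x + t • d) ⬝ᵥ g := by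
  -- The ratio test: `t` is the first time at which a facet inequality at `u` becomes tight. The
  -- point reached lies in the hyperplane of `K`, within the cone spanned by the two neighbours of
  -- `u` in `K`.
  obtain ⟨K, ⟨uK, dK⟩, hmin⟩ := Set.exists_min_image {K | R.I u K ∧ d ⬝ᵥ R.f K < 0}
    (fun K => (x ⬝ᵥ R.f K) / (- (d ⬝ᵥ R.f K))) (Set.toFinite _) hd
  set t := (x ⬝ᵥ R.f K) / (- (d ⬝ᵥ R.f K)) with ht
  have ht0 : 0 ≤ t := div_nonneg (hx K uK) (by linarith)
  refine ⟨t, ht0, ?_⟩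
  have hy : ∀ H, R.I u H → 0 ≤ (x + t • d) ⬝ᵥ R.f H := by
    intro H uH
    simp only [add_dotProduct, smul_dotProduct, smul_eq_mul]
    rcases lt_or_ge (d ⬝ᵥ R.f H) 0 with h | h
    · have := hmin H ⟨uH, h⟩
      rw [le_div_iff₀ (by linarith)] at this
      linarith
    · have := hx H uH
      positivity
  have hyK : (x + t • d) ⬝ᵥ R.f K = 0 := by
    simp only [add_dotProduct, smul_dotProduct, smul_eq_mul, ht]
    have : d ⬝ᵥ R.f K ≠ 0 := dK.ne
    field_simp
    ring
  obtain ⟨a, b, A, B, hf⟩ := R.flag u K uK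
  obtain ⟨c, hc⟩ := R.exists_coords_of_flag hf R.p R.f R.zero_iff hyK
  rw [hc, add_dotProduct, add_dotProduct, smul_dotProduct, smul_dotProduct, smul_dotProduct, gu]
  have := hg K a ((R.nbr_iff hf a).2 (Or.inl rfl))
  have := hg K b ((R.nbr_iff hf b).2 (Or.inr rfl))
  have := hy A hf.vA
  have := hy B hf.vB
  have := R.nonneg a B
  have := R.nonneg b A
  simp only [smul_eq_mul, mul_zero, zero_add]
  positivity

/-- A local minimum is global: `w` is moved along `a - b` and along `b - a` until it leaves the cone
at `u`, where `g` is nonnegative. One of the two moves does not increase `g`, so `g` is nonnegative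
at `w`. Hence `u` lies in a facet `H` through `w`, and `facet_connected` finishes inside `H`. -/
theorem connected [Finite V] [Finite F] (R : PolyRep V F) (C : Set V)
    (hne : C.Nonempty) (hC : ∀ u ∈ C, ∀ G w, R.Nbr G u w → w ∈ C) (w : V) : w ∈ C := by
  have := Fintype.ofFinite F
  obtain ⟨H, wH⟩ := R.exists_facet w
  obtain ⟨u, huC, g, gu, gC, gH⟩ := R.exists_minimizer H C hne
  have hg : ∀ G w, R.Nbr G u w → 0 ≤ R.p w ⬝ᵥ g := fun G w h => gC w (hC u huC G w h)
  refine R.facet_connected C ⟨u, huC, ?_⟩ (fun u hu w => hC u hu H w) w wH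
  apply gH w wH
  obtain ⟨G, uG⟩ := R.exists_facet u
  obtain ⟨a, b, A, B, hf⟩ := R.flag u G uG
  have hw : ∀ K, R.I u K → 0 ≤ R.p w ⬝ᵥ R.f K := fun K _ => R.nonneg w K
  obtain ⟨s, hs, hs'⟩ := R.exists_exit gu hg hw (d := R.p a - R.p b) ⟨A, hf.vA, by
    rw [sub_dotProduct, R.zero hf.aA]; linarith [R.pos hf.bA]⟩
  obtain ⟨t, ht, ht'⟩ := R.exists_exit gu hg hw (d := R.p b - R.p a) ⟨B, hf.vB, by
    rw [sub_dotProduct, R.zero hf.bB]; linarith [R.pos hf.aB]⟩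
  simp only [add_dotProduct, sub_dotProduct, smul_dotProduct, smul_eq_mul] at hs' ht'
  by_contra! hneg
  rcases le_total (R.p a ⬝ᵥ g) (R.p b ⬝ᵥ g) with h | h
  · nlinarith [mul_nonneg hs (sub_nonneg.2 h)]
  · nlinarith [mul_nonneg ht (sub_nonneg.2 h)]

/-! ### Incidence tables that are complete -/

/-- An incidence table that is closed under passing to neighbouring vertices and facets. -/
structure IsClosedTable {m k : ℕ} (T : Fin m → Fin k → Bool) : Prop where
  pos : 0 < m
  exists_col : ∀ a, ∃ b, T a b
  exists_row : ∀ b, ∃ a, T a b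
  exists_not : ∀ b, ∃ a, T a b = false
  row_anti : ∀ a a', (∀ b, T a b → T a' b) → a = a'
  col_anti : ∀ b b', (∀ a, T a b → T a b') → b = b'
  nbrs : ∀ a b, T a b → ∃ a', (T a' b ∧ a' ≠ a) ∧ ∃ b', (b' ≠ b ∧ T a b' ∧ T a' b') ∧
    ∃ a'', (T a'' b ∧ T a'' b' = false) ∧ ∃ b'', b'' ≠ b ∧ T a b'' ∧ T a'' b'' ∧ T a' b'' = false

/-- Incidences are only assumed between listed vertices and facets. Since the table already shows
both neighbours in every flag, the listed elements are closed under passing to neighbours, and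
connectivity, used dually for the facets at a vertex, leaves nothing else. -/
theorem bijective_of_table [Finite V] [Finite F] (R : PolyRep V F) {m k : ℕ}
    {T : Fin m → Fin k → Bool} (hT : IsClosedTable T) (i : Fin m → V) (j : Fin k → F)
    (hij : ∀ a b, R.I (i a) (j b) ↔ T a b = true) :
    Function.Bijective i ∧ Function.Bijective j := by
  have hi : Function.Injective i := fun a a' h => hT.row_anti a a' fun b => by
    rw [← hij, ← hij, h]; exact id
  have hj : Function.Injective j := fun b b' h => hT.col_anti b b' fun a => by
    rw [← hij, ← hij, h]; exact id
  have key : ∀ a b, T a b = true → ∃ a1 a2 b1 b2, IsFlag R.I (i a) (j b) (i a1) (i a2) (j b1) (j b2) := by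
    intro a b hab
    obtain ⟨a1, ⟨h1, h2⟩, b1, ⟨h3, h4, h5⟩, a2, ⟨h7, h12⟩, b2, h9, h10, h11, h13⟩ := hT.nbrs a b hab
    have h6 : a2 ≠ a1 := by
      rintro rfl
      simp [h5] at h12
    have h8 : a2 ≠ a := by
      rintro rfl
      simp [h4] at h12
    obtain ⟨α, β, A, B, hf⟩ := R.flag _ _ ((hij a b).2 hab)
    have e1 := hf.eq_or_eq ((hij _ _).2 h1) ((hij _ _).2 h4) ((hij _ _).2 h5) (hi.ne h2) (hj.ne h3)
    have e2 := hf.eq_or_eq ((hij _ _).2 h7) ((hij _ _).2 h10) ((hij _ _).2 h11) (hi.ne h8) (hj.ne h9)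
    have e3 := hi.ne h6
    rcases e1 with ⟨rfl, rfl⟩ | ⟨rfl, rfl⟩
    · obtain ⟨rfl, rfl⟩ := e2.resolve_left fun h => e3 h.1
      exact ⟨_, _, _, _, hf⟩
    · obtain ⟨rfl, rfl⟩ := e2.resolve_right fun h => e3 h.1
      exact ⟨_, _, _, _, hf.swap⟩
  have hfac : ∀ a G, R.I (i a) G → G ∈ Set.range j := by
    intro a
    refine R.dual.facet_connected (G := i a) (Set.range j) ?_ ?_
    · obtain ⟨b, hb⟩ := hT.exists_col a
      exact ⟨j b, ⟨b, rfl⟩, (hij a b).2 hb⟩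
    · rintro _ ⟨b, rfl⟩ K hK
      obtain ⟨a1, a2, b1, b2, hf⟩ := key a b ((hij a b).1 hK.2.1)
      rcases (R.dual.nbr_iff hf.dual K).1 hK with rfl | rfl
      exacts [⟨_, rfl⟩, ⟨_, rfl⟩]
  have hver : ∀ w, w ∈ Set.range i := by
    refine R.connected (Set.range i) ⟨i ⟨0, hT.pos⟩, ⟨_, rfl⟩⟩ ?_
    rintro _ ⟨a, rfl⟩ G w hw
    obtain ⟨b, rfl⟩ := hfac a G hw.2.1
    obtain ⟨a1, a2, b1, b2, hf⟩ := key a b ((hij a b).1 hw.2.1)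
    rcases (R.nbr_iff hf w).1 hw with rfl | rfl
    exacts [⟨_, rfl⟩, ⟨_, rfl⟩]
  refine ⟨⟨hi, hver⟩, ⟨hj, fun G => ?_⟩⟩
  obtain ⟨u, hu⟩ := R.exists_vertex G
  obtain ⟨a, rfl⟩ := hver u
  exact hfac a G hu

end PolyRep

/-! ### Obstructions to a square root of the slack matrix -/

/-- The vertices `v₁, …, v₄` of a quadrilateral facet `G` in cyclic order, and the facets `Eᵢ`
that meet `G` in the edges `vᵢ vᵢ₊₁`. -/
structure IsQuad {V F : Type*} (I : V → F → Prop) (G : F) (v₁ v₂ v₃ v₄ : V)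
    (E₁ E₂ E₃ E₄ : F) : Prop where
  v12 : v₁ ≠ v₂
  v13 : v₁ ≠ v₃
  v14 : v₁ ≠ v₄
  v23 : v₂ ≠ v₃
  v24 : v₂ ≠ v₄
  v34 : v₃ ≠ v₄
  E1G : E₁ ≠ G
  E2G : E₂ ≠ G
  E3G : E₃ ≠ G
  E4G : E₄ ≠ G
  E12 : E₁ ≠ E₂
  E13 : E₁ ≠ E₃
  E14 : E₁ ≠ E₄
  E23 : E₂ ≠ E₃
  E24 : E₂ ≠ E₄
  E34 : E₃ ≠ E₄
  vert : ∀ w, I w G ↔ w = v₁ ∨ w = v₂ ∨ w = v₃ ∨ w = v₄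
  fac1 : ∀ H, I v₁ H ↔ H = G ∨ H = E₄ ∨ H = E₁
  fac2 : ∀ H, I v₂ H ↔ H = G ∨ H = E₁ ∨ H = E₂
  fac3 : ∀ H, I v₃ H ↔ H = G ∨ H = E₂ ∨ H = E₃
  fac4 : ∀ H, I v₄ H ↔ H = G ∨ H = E₃ ∨ H = E₄

theorem IsQuad.rotate {V F : Type*} {I : V → F → Prop} {G : F} {v₁ v₂ v₃ v₄ : V}
    {E₁ E₂ E₃ E₄ : F} (h : IsQuad I G v₁ v₂ v₃ v₄ E₁ E₂ E₃ E₄) :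
    IsQuad I G v₂ v₃ v₄ v₁ E₂ E₃ E₄ E₁ where
  v12 := h.v23
  v13 := h.v24
  v14 := h.v12.symm
  v23 := h.v34
  v24 := h.v13.symm
  v34 := h.v14.symm
  E1G := h.E2G
  E2G := h.E3G
  E3G := h.E4G
  E4G := h.E1G
  E12 := h.E23
  E13 := h.E24
  E14 := h.E12.symm
  E23 := h.E34
  E24 := h.E13.symm
  E34 := h.E14.symm
  vert w := by rw [h.vert w]; tauto
  fac1 := h.fac2
  fac2 := h.fac3
  fac3 := h.fac4
  fac4 := h.fac1

/-- The identity behind the trinomial obstruction. -/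
theorem trinomial_identity {q g : Fin 4 → Fin 4 → ℝ} {n : Fin 4 → ℝ} (hn : n ≠ 0)
    (hq : ∀ i, q i ⬝ᵥ n = 0) (h00 : q 0 ⬝ᵥ g 0 = 0) (h10 : q 1 ⬝ᵥ g 0 = 0)
    (h11 : q 1 ⬝ᵥ g 1 = 0) (h21 : q 2 ⬝ᵥ g 1 = 0) (h22 : q 2 ⬝ᵥ g 2 = 0) (h32 : q 3 ⬝ᵥ g 2 = 0)
    (h33 : q 3 ⬝ᵥ g 3 = 0) :
    (q 0 ⬝ᵥ g 2) * (q 1 ⬝ᵥ g 3) * (q 2 ⬝ᵥ g 0) * (q 3 ⬝ᵥ g 1) =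
      (q 0 ⬝ᵥ g 1) * (q 1 ⬝ᵥ g 2) * (q 2 ⬝ᵥ g 3) * (q 3 ⬝ᵥ g 0) +
      (q 0 ⬝ᵥ g 3) * (q 1 ⬝ᵥ g 2) * (q 2 ⬝ᵥ g 0) * (q 3 ⬝ᵥ g 1) := by
  -- All `q i` lie in the hyperplane orthogonal to `n`, so the 4 × 4 matrix of pairings is singular.
  -- With the seven prescribed zeros, exactly three terms of its determinant survive.
  have h1 : (Matrix.of q).det = 0 :=
    Matrix.exists_mulVec_eq_zero_iff.1 ⟨n, hn, funext hq⟩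
  have h2 : (Matrix.of q * (Matrix.of g)ᵀ).det = 0 := by rw [Matrix.det_mul, h1, zero_mul]
  have h3 : ∀ i j, (Matrix.of q * (Matrix.of g)ᵀ) i j = q i ⬝ᵥ g j := fun i j => rfl
  generalize Matrix.of q * (Matrix.of g)ᵀ = N at h2 h3
  simp only [← h3] at *
  simp only [Matrix.det_succ_row_zero, Fin.sum_univ_succ, Matrix.submatrix_apply,
    Matrix.det_unique] at h2
  simp [Fin.succAbove, h00, h10, h11, h21, h22, h32, h33] at h2
  linear_combination h2

namespace PolyRep
variable {V F : Type*}

/-- The slack matrix has an entrywise square root of rank at most four. -/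
def HasSqrt (R : PolyRep V F) : Prop :=
  ∃ (x : V → Fin 4 → ℝ) (y : F → Fin 4 → ℝ), ∀ v G, (x v ⬝ᵥ y G) ^ 2 = R.p v ⬝ᵥ R.f G

theorem HasSqrt.dual {R : PolyRep V F} (h : R.HasSqrt) : R.dual.HasSqrt := by
  obtain ⟨x, y, h⟩ := h
  refine ⟨y, x, fun G v => ?_⟩
  rw [dotProduct_comm, h v G, dotProduct_comm]
  rfl

theorem flag_with (R : PolyRep V F) {u w : V} {G H : F} (uG : R.I u G) (wG : R.I w G)
    (uH : R.I u H) (wH : R.I w H) (wu : w ≠ u) (HG : H ≠ G) :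
    ∃ c C, IsFlag R.I u G w c H C := by
  obtain ⟨a, b, A, B, hf⟩ := R.flag u G uG
  rcases hf.eq_or_eq wG uH wH wu HG with ⟨rfl, rfl⟩ | ⟨rfl, rfl⟩
  exacts [⟨_, _, hf⟩, ⟨_, _, hf.swap⟩]

/-- A facet with a fourth vertex has only simple vertices. -/
theorem facet_of_fourth_vertex {R : PolyRep V F} (hs : R.HasSqrt) {v G a b A B}
    (hf : IsFlag R.I v G a b A B) {w : V} (wG : R.I w G) (wv : w ≠ v) (wa : w ≠ a) (wb : w ≠ b)
    {H : F} (vH : R.I v H) : H = G ∨ H = A ∨ H = B := by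
  obtain ⟨x, y, hxy⟩ := hs
  by_contra! hH
  have hz : ∀ v G, x v ⬝ᵥ y G = 0 ↔ R.I v G := fun v G => by
    rw [← R.zero_iff, ← hxy, sq_eq_zero_iff]
  obtain ⟨c, hc⟩ := R.exists_coords_of_flag hf R.p R.f R.zero_iff (R.zero wG)
  obtain ⟨d, hd⟩ := R.exists_coords_of_flag hf x y hz ((hz _ _).2 wG)
  have h1 : R.p w ⬝ᵥ R.f H = _ := congrArg (· ⬝ᵥ R.f H) hc
  have h2 : x w ⬝ᵥ y H = _ := congrArg (· ⬝ᵥ y H) hd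
  -- On `H`, which contains `v`, the unknown coefficient of `v` drops out. With `s`, `t` the two
  -- remaining terms for the root, the slacks give `(s + t)² = s² + t²`, while both `s` and `t` are
  -- nonzero.
  simp only [add_dotProduct, smul_dotProduct, (R.zero_iff _ _).2 vH, (hz _ _).2 vH, smul_eq_mul,
    mul_zero, zero_add, ← hxy, ← div_pow, ← mul_pow] at h1 h2
  rw [h2] at h1
  have nz : ∀ {v G}, ¬ R.I v G → x v ⬝ᵥ y G ≠ 0 := fun h h0 => h ((hz _ _).1 h0)
  have hwB : ¬ R.I w B := by simp [hf.inc_iff w B wG hf.vB, wv, wa, wb, hf.BG]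
  have hwA : ¬ R.I w A := by simp [hf.inc_iff w A wG hf.vA, wv, wa, wb, hf.AG]
  have haH : ¬ R.I a H := by simp [hf.inc_iff a H hf.aG vH, hf.av, hf.ab, hH]
  have hbH : ¬ R.I b H := by simp [hf.inc_iff b H hf.bG vH, hf.bv, hf.ab.symm, hH]
  have := mul_ne_zero (mul_ne_zero (div_ne_zero (nz hwB) (nz hf.aB)) (nz haH))
    (mul_ne_zero (div_ne_zero (nz hwA) (nz hf.bA)) (nz hbH))
  exact this (by linear_combination h1 / 2)

/-- A facet of a polytope with a square root of the slack matrix is a triangle or a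
quadrilateral. -/
theorem facet_cases [Finite V] [Finite F] {R : PolyRep V F} (hs : R.HasSqrt) {v G a b A B}
    (hf : IsFlag R.I v G a b A B) : (∀ w, R.I w G → w = v ∨ w = a ∨ w = b) ∨
      ∃ d C D, IsQuad R.I G a v b d A B C D := by
  by_cases hw : ∀ w, R.I w G → w = v ∨ w = a ∨ w = b
  · exact Or.inl hw
  right
  push Not at hw
  obtain ⟨w, wG, wv, wa, wb⟩ := hw
  obtain ⟨d, C, hb⟩ := R.flag_with hf.bG hf.vG hf.bB hf.vB hf.bv.symm hf.BG
  obtain ⟨e', E', ha⟩ := R.flag_with hf.aG hf.vG hf.aA hf.vA hf.av.symm hf.AG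
  -- If `d = a`, then `v`, `a`, `b` are closed under neighbours in `G`, which leaves no room for
  -- `w`.
  have hda : d ≠ a := by
    rintro rfl
    have hb' : IsFlag R.I d G v b A C := by
      rcases ha.eq_or_eq hf.bG hb.bB hb.vB hf.ab.symm hb.BG with ⟨h, -⟩ | ⟨rfl, rfl⟩
      · exact absurd h hf.bv
      · exact ha
    have := R.facet_connected (G := G) {u | u = v ∨ u = d ∨ u = b} ⟨v, Or.inl rfl, hf.vG⟩ ?_ w wG
    · simp [wv, wa, wb] at this
    · rintro _ (rfl | rfl | rfl) z hz
      · have := (R.nbr_iff hf z).1 hz; simp; tauto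
      · have := (R.nbr_iff hb' z).1 hz; simp; tauto
      · have := (R.nbr_iff hb z).1 hz; simp; tauto
  obtain ⟨e, D, hd⟩ := R.flag_with hb.bG hf.bG hb.bB hb.vB hb.bv.symm hb.BG
  -- If the walk `a, v, b, d` returns to `a`, these four are all vertices of `G`, and each has
  -- degree three because the facet has a fourth vertex.
  by_cases hea : e = a
  · subst hea
    have hD : IsFlag R.I e G v d A D := by
      rcases ha.eq_or_eq hb.bG hd.bB hd.vB hd.bv.symm hd.BG with ⟨h, -⟩ | ⟨rfl, rfl⟩
      · exact absurd h hb.ab.symm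
      · exact ha
    have hall := R.facet_connected (G := G) {u | u = e ∨ u = v ∨ u = b ∨ u = d}
      ⟨v, by simp, hf.vG⟩ (by
        rintro _ (rfl | rfl | rfl | rfl) z hz
        · have := (R.nbr_iff hD z).1 hz; simp; tauto
        · have := (R.nbr_iff hf z).1 hz; simp; tauto
        · have := (R.nbr_iff hb z).1 hz; simp; tauto
        · have := (R.nbr_iff hd z).1 hz; simp; tauto)
    have hCA : C ≠ A := by
      rintro rfl
      exact hf.bA hb.vB
    have hDB : D ≠ B := by
      rintro rfl
      exact hb.bA hd.vB
    refine ⟨d, C, D, ?_⟩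
    constructor
    case vert =>
      intro w
      refine ⟨hall w, ?_⟩
      rintro (rfl | rfl | rfl | rfl)
      exacts [hf.aG, hf.vG, hf.bG, hb.bG]
    case fac1 =>
      intro H
      refine ⟨fun h => ?_, ?_⟩
      · have := facet_of_fourth_vertex hs hD hf.bG hf.ab.symm hf.bv hb.bv.symm h
        tauto
      · rintro (rfl | rfl | rfl)
        exacts [hf.aG, hD.vB, hf.aA]
    case fac2 =>
      intro H
      refine ⟨fun h => ?_, ?_⟩
      · have := facet_of_fourth_vertex hs hf hb.bG hb.ab.symm hda hb.bv h
        tauto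
      · rintro (rfl | rfl | rfl)
        exacts [hf.vG, hf.vA, hf.vB]
    case fac3 =>
      intro H
      refine ⟨fun h => ?_, ?_⟩
      · have := facet_of_fourth_vertex hs hb hf.aG hf.ab hf.av hda.symm h
        tauto
      · rintro (rfl | rfl | rfl)
        exacts [hf.bG, hf.bB, hb.vB]
    case fac4 =>
      intro H
      refine ⟨fun h => ?_, ?_⟩
      · have := facet_of_fourth_vertex hs hd hf.vG hb.ab hf.bv.symm hf.av.symm h
        tauto
      · rintro (rfl | rfl | rfl)
        exacts [hb.bG, hd.vA, hd.vB]
    exacts [hf.av, hf.ab, hda.symm, hf.bv.symm, hb.ab, hb.bv.symm, hf.AG, hf.BG, hb.BG, hd.BG,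
      hf.AB, hCA.symm, hD.AB, hb.AB, hDB.symm, hd.AB]
  -- Otherwise `G` has at least five vertices. The trinomial identity for the path `a, v, b, d` and
  -- the facets across its edges and the next one holds for the slacks and for their roots, and all
  -- entries in its terms are nonzero.
  · exfalso
    have hev : e ≠ v := by
      rintro rfl
      rcases hf.eq_or_eq hb.bG hd.bB hd.vB hb.ab.symm hd.BG with ⟨h, -⟩ | ⟨h, -⟩
      exacts [hda h, hb.bv h]
    obtain ⟨x, y, hxy⟩ := hs
    have hz : ∀ v G, x v ⬝ᵥ y G = 0 ↔ R.I v G := fun v G => by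
      rw [← R.zero_iff, ← hxy, sq_eq_zero_iff]
    obtain ⟨u, hu⟩ := R.dual.exists_not_mem G
    have hu : ¬ R.I u G := hu
    have off : ∀ {H s t z}, H ≠ G → s ≠ t → R.I s G → R.I t G → R.I z G → R.I s H → R.I t H →
        z ≠ s → z ≠ t → ¬ R.I z H := fun hH hst sG tG zG sH tH hs ht zH =>
      (R.two hH.symm hst sG tG zG sH tH zH).elim hs ht
    have nz : ∀ {v G}, ¬ R.I v G → x v ⬝ᵥ y G ≠ 0 := fun h h0 => h ((hz _ _).1 h0)
    have aB := nz hf.aB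
    have bA := nz hf.bA
    have aC := nz (off hb.BG hb.bv.symm hf.bG hb.bG hf.aG hb.vB hb.bB hf.ab hda.symm)
    have vC := nz (off hb.BG hb.bv.symm hf.bG hb.bG hf.vG hb.vB hb.bB hf.bv.symm hb.ab)
    have aD := nz (off hd.BG hd.bv.symm hb.bG hd.bG hf.aG hd.vB hd.bB hda.symm (Ne.symm hea))
    have vD := nz (off hd.BG hd.bv.symm hb.bG hd.bG hf.vG hd.vB hd.bB hb.ab hev.symm)
    have bD := nz hd.aB
    have dA := nz (off hf.AG hf.av hf.aG hf.vG hb.bG hf.aA hf.vA hda hb.ab.symm)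
    have dB := nz hb.bA
    have uG : R.f G ≠ 0 := fun h => R.ne_zero hu (by rw [h, dotProduct_zero])
    have uG' : y G ≠ 0 := fun h => nz hu (by rw [h, dotProduct_zero])
    have h1 := trinomial_identity (q := ![R.p a, R.p v, R.p b, R.p d])
      (g := ![R.f A, R.f B, R.f C, R.f D]) uG
      (by simp [Fin.forall_fin_succ, R.zero_iff, hf.aG, hf.vG, hf.bG, hb.bG])
      (R.zero hf.aA) (R.zero hf.vA) (R.zero hf.vB) (R.zero hf.bB) (R.zero hb.vB) (R.zero hb.bB)
      (R.zero hd.vB)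
    have h2 := trinomial_identity (q := ![x a, x v, x b, x d])
      (g := ![y A, y B, y C, y D]) uG'
      (by simp [Fin.forall_fin_succ, hz, hf.aG, hf.vG, hf.bG, hb.bG])
      ((hz _ _).2 hf.aA) ((hz _ _).2 hf.vA) ((hz _ _).2 hf.vB) ((hz _ _).2 hf.bB)
      ((hz _ _).2 hb.vB) ((hz _ _).2 hb.bB) ((hz _ _).2 hd.vB)
    simp only [Matrix.cons_val, ← hxy, ← mul_pow] at h1 h2
    rw [h2] at h1
    refine mul_ne_zero (mul_ne_zero (mul_ne_zero (mul_ne_zero aB vC) bD) dA)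
      (mul_ne_zero (mul_ne_zero (mul_ne_zero aD vC) bA) dB) ?_
    linear_combination h1 / 2

end PolyRep

/-! ### Combinatorial classification -/

/-- The incidence relation is given, up to relabelling, by the table `T`. -/
def HasTable {V F : Type*} (I : V → F → Prop) {m k : ℕ} (T : Fin m → Fin k → Bool) : Prop :=
  ∃ (i : Fin m ≃ V) (j : Fin k ≃ F), ∀ a b, I (i a) (j b) ↔ T a b = true

/-- Vertex-facet incidences of a tetrahedron. -/
def simplexTable : Fin 4 → Fin 4 → Bool :=
  ![![true, true, true, false],
    ![true, true, false, true],
    ![true, false, true, true],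
    ![false, true, true, true]]

/-- Vertex-facet incidences of a quadrilateral pyramid; the apex comes first and the base last. -/
def pyramidTable : Fin 5 → Fin 5 → Bool :=
  ![![true, true, true, true, false],
    ![true, true, false, false, true],
    ![false, true, true, false, true],
    ![false, false, true, true, true],
    ![true, false, false, true, true]]

/-- Vertex-facet incidences of a bipyramid over a triangle; the second and the fourth vertex are
the apices. -/
def bisimplexTable : Fin 5 → Fin 6 → Bool :=
  ![![true, true, true, true, false, false],
    ![true, true, false, false, true, false],
    ![false, true, true, false, true, true],
    ![false, false, true, true, false, true],
    ![true, false, false, true, true, true]]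

/-- Vertex-facet incidences of an octahedron; the first and the last vertex are opposite. -/
def octahedronTable : Fin 6 → Fin 8 → Bool :=
  ![![true, true, true, true, false, false, false, false],
    ![true, true, false, false, true, true, false, false],
    ![false, true, true, false, false, true, true, false],
    ![false, false, true, true, false, false, true, true],
    ![true, false, false, true, true, false, false, true],
    ![false, false, false, false, true, true, true, true]]

theorem isClosedTable_simplex : PolyRep.IsClosedTable simplexTable :=
  ⟨by decide, by decide, by decide, by decide, by decide, by decide, by decide⟩

theorem isClosedTable_pyramid : PolyRep.IsClosedTable pyramidTable :=
  ⟨by decide, by decide, by decide, by decide, by decide, by decide, by decide⟩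

theorem isClosedTable_bisimplex : PolyRep.IsClosedTable bisimplexTable :=
  ⟨by decide, by decide, by decide, by decide, by decide, by decide, by decide⟩

set_option maxRecDepth 4000 in
theorem isClosedTable_octahedron : PolyRep.IsClosedTable octahedronTable :=
  ⟨by decide, by decide, by decide, by decide, by decide, by decide, by decide⟩

namespace PolyRep
variable {V F : Type*}

theorem hasTable_of_table [Finite V] [Finite F] (R : PolyRep V F) {m k : ℕ}
    {T : Fin m → Fin k → Bool} (hT : IsClosedTable T) (i : Fin m → V) (j : Fin k → F)
    (hij : ∀ a b, R.I (i a) (j b) ↔ T a b = true) : HasTable R.I T :=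
  ⟨Equiv.ofBijective i (R.bijective_of_table hT i j hij).1,
    Equiv.ofBijective j (R.bijective_of_table hT i j hij).2, hij⟩

/-- The facet `G` has at most three vertices. -/
def IsTriangle (R : PolyRep V F) (G : F) : Prop :=
  ∃ a b c, ∀ w, R.I w G → w = a ∨ w = b ∨ w = c

theorem IsTriangle.iff {R : PolyRep V F} {G : F} (h : R.IsTriangle G) {x y z : V} (hx : R.I x G)
    (hy : R.I y G) (hz : R.I z G) (xy : x ≠ y) (xz : x ≠ z) (yz : y ≠ z) (w : V) :
    R.I w G ↔ w = x ∨ w = y ∨ w = z := by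
  obtain ⟨a, b, c, h⟩ := h
  have h1 := h x hx
  have h2 := h y hy
  have h3 := h z hz
  have h4 := h w
  constructor
  · grind
  · rintro (rfl | rfl | rfl) <;> assumption

theorem isTriangle_or_isQuad [Finite V] [Finite F] {R : PolyRep V F} (hs : R.HasSqrt) (G : F) :
    R.IsTriangle G ∨ ∃ a b c d A B C D, IsQuad R.I G a b c d A B C D := by
  obtain ⟨v, hv⟩ := R.exists_vertex G
  obtain ⟨a, b, A, B, hf⟩ := R.flag v G hv
  rcases facet_cases hs hf with h | ⟨d, C, D, h⟩
  · exact Or.inl ⟨_, _, _, h⟩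
  · exact Or.inr ⟨_, _, _, _, _, _, _, _, h⟩

/-- Each new flag has its third vertex or third facet forced by the bounds on facet size and degree,
so the walk closes up after four vertices and four facets. -/
theorem hasTable_simplex [Finite V] [Finite F] [Nonempty V] {R : PolyRep V F}
    (hG : ∀ G, R.IsTriangle G) (hv : ∀ v, R.dual.IsTriangle v) : HasTable R.I simplexTable := by
  obtain ⟨v⟩ := ‹Nonempty V›
  obtain ⟨G, vG⟩ := R.exists_facet v
  obtain ⟨a, b, A, B, hf⟩ := R.flag v G vG
  have iG := (hG G).iff hf.vG hf.aG hf.bG hf.av.symm hf.bv.symm hf.ab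
  have iv := (hv v).iff (x := G) (y := A) (z := B) hf.vG hf.vA hf.vB hf.AG.symm hf.BG.symm hf.AB
  obtain ⟨c, C, hA⟩ := R.flag_with hf.vA hf.aA hf.vG hf.aG hf.av hf.AG.symm
  have hCB : C = B := by
    have := (iv C).1 hA.vB
    have := hA.BG
    have := hA.AB
    tauto
  subst hCB
  have iA := (hG A).iff hf.vA hf.aA hA.bG hf.av.symm hA.bv.symm hA.ab
  have bc : b ≠ c := fun h => hf.bA (h ▸ hA.bG)
  have iB := (hG C).iff hf.vB hf.bB hA.bB hf.bv.symm hA.bv.symm bc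
  obtain ⟨b', K, ha⟩ := R.flag_with hf.aG hf.vG hf.aA hf.vA hf.av.symm hf.AG
  have hbb : b' = b := by
    have := (iG b').1 ha.bG
    have := ha.ab
    have := ha.bv
    tauto
  subst hbb
  have ia := (hv a).iff (x := G) (y := A) (z := K) hf.aG hf.aA ha.vB hf.AG.symm ha.BG.symm ha.AB
  obtain ⟨c', K', ha'⟩ := R.flag_with hf.aA hf.vA hf.aG hf.vG hf.av.symm hf.AG.symm
  have hcc : c' = c := by
    have := (iA c').1 ha'.bG
    have := ha'.ab
    have := ha'.bv
    tauto
  subst hcc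
  have hKK : K' = K := by
    have := (ia K').1 ha'.vB
    have := ha'.BG
    have := ha'.AB
    tauto
  subst hKK
  have iK := (hG K').iff ha.vB ha.bB ha'.bB hf.ab hA.ab bc
  have h1 := hf.av
  have h2 := hf.bv
  have h3 := hf.ab
  have h4 := hA.bv
  have h5 := hA.ab
  refine R.hasTable_of_table isClosedTable_simplex ![v, a, b', c'] ![G, A, C, K'] ?_
  simp [Fin.forall_fin_succ, simplexTable, iG, iA, iB, iK, h1, h2, h3, h4, h5, h1.symm, h2.symm,
    h3.symm, h4.symm, h5.symm, bc, bc.symm]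

/-- An `IsQuad` for `R.dual` describes a vertex `v` of degree four: its facets are the triangles `G₁
= v e₄ e₁`, `G₂ = v e₁ e₂`, `G₃ = v e₂ e₃`, `G₄ = v e₃ e₄`. Of these only `G₁` contains both `e₄`
and `e₁`. -/
theorem not_mem_of_edge {R : PolyRep V F} {v e₁ e₂ e₃ e₄ : V} {G₁ G₂ G₃ G₄ H : F}
    (hq : IsQuad R.dual.I v G₁ G₂ G₃ G₄ e₁ e₂ e₃ e₄) (hH : H ≠ G₁) (h4 : R.I e₄ H)
    (h1 : R.I e₁ H) : ¬ R.I v H := by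
  intro hv
  rcases (hq.vert H).1 hv with rfl | rfl | rfl | rfl
  · exact hH rfl
  · simpa [hq.E14.symm, hq.E24.symm, hq.E4G] using (hq.fac2 e₄).1 h4
  · simpa [hq.E34.symm, hq.E24.symm, hq.E4G] using (hq.fac3 e₄).1 h4
  · simpa [hq.E13, hq.E14, hq.E1G] using (hq.fac4 e₁).1 h1

theorem exists_facet_behind {R : PolyRep V F} {v e₁ e₂ e₃ e₄ : V} {G₁ G₂ G₃ G₄ : F}
    (hq : IsQuad R.dual.I v G₁ G₂ G₃ G₄ e₁ e₂ e₃ e₄) :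
    ∃ H, H ≠ G₁ ∧ R.I e₄ H ∧ R.I e₁ H ∧ ¬ R.I v H := by
  have iG₁ : ∀ w, R.I w G₁ ↔ w = v ∨ w = e₄ ∨ w = e₁ := hq.fac1
  have iG₂ : ∀ w, R.I w G₂ ↔ w = v ∨ w = e₁ ∨ w = e₂ := hq.fac2
  obtain ⟨c, C, hf⟩ := R.flag_with (u := e₁) (w := v) (G := G₁) (H := G₂) (by simp [iG₁])
    (by simp [iG₁]) (by simp [iG₂]) (by simp [iG₂]) hq.E1G.symm hq.v12.symm
  have hc : c = e₄ := by
    have := (iG₁ c).1 hf.bG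
    have := hf.ab
    have := hf.bv
    tauto
  subst hc
  exact ⟨C, hf.BG, hf.bB, hf.vB, not_mem_of_edge hq hf.BG hf.bB hf.vB⟩

variable [Finite V] [Finite F] {R : PolyRep V F}

/-- At a vertex `v` of degree four with facets `v e₄ e₁` and `v e₁ e₂`, the facets behind the
edges `e₄ e₁` and `e₁ e₂` coincide or are triangles with a common third vertex. -/
theorem corner (hs : R.HasSqrt) {v e₁ e₂ e₃ e₄ : V} {G₁ G₂ G₃ G₄ H H' : F}
    (hq : IsQuad R.dual.I v G₁ G₂ G₃ G₄ e₁ e₂ e₃ e₄) (hH : H ≠ G₁) (h4 : R.I e₄ H)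
    (h1 : R.I e₁ H) (hH' : H' ≠ G₂) (h1' : R.I e₁ H') (h2' : R.I e₂ H') :
    H' = H ∨ ∃ c, c ≠ e₁ ∧ c ≠ e₄ ∧ c ≠ e₂ ∧ (∀ w, R.I w H ↔ w = e₁ ∨ w = e₄ ∨ w = c) ∧
      (∀ w, R.I w H' ↔ w = e₁ ∨ w = c ∨ w = e₂) := by
  have hvG : ∀ K, R.I v K ↔ K = G₁ ∨ K = G₂ ∨ K = G₃ ∨ K = G₄ := hq.vert
  have iG₁ : ∀ w, R.I w G₁ ↔ w = v ∨ w = e₄ ∨ w = e₁ := hq.fac1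
  have iG₂ : ∀ w, R.I w G₂ ↔ w = v ∨ w = e₁ ∨ w = e₂ := hq.fac2
  obtain ⟨c, C, hf⟩ := R.flag_with (u := e₁) (w := v) (G := G₁) (H := G₂) (by simp [iG₁])
    (by simp [iG₁]) (by simp [iG₂]) (by simp [iG₂]) hq.E1G.symm hq.v12.symm
  obtain ⟨rfl, rfl⟩ := (hf.eq_or_eq (w := e₄) (H := H) (by simp [iG₁]) h1 h4 hq.E14.symm hH).resolve_left
    fun h => hq.E4G h.1
  have e2H1 : ¬ R.I e₂ G₁ := by simp [iG₁, hq.E2G, hq.E24, hq.E12.symm]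
  have hHG₁ : H' ≠ G₁ := fun h => e2H1 (h ▸ h2')
  -- The dichotomy is applied to the degree of `e₁`. Degree three leaves only `G₁`, `G₂`, `H`, so
  -- `H' = H`; degree four makes every facet at `e₁` a triangle, and `H`, `H'` share the edge `e₁
  -- m`.
  rcases facet_cases hs.dual hf.dual with h | ⟨D, m, d, h⟩
  · left
    have := h H' h1'
    tauto
  · right
    have hD : R.I d D ∧ R.I d G₂ := ⟨(h.fac4 d).2 (by tauto), (h.fac1 d).2 (by tauto)⟩
    have hd : d = e₂ := by
      have := (iG₂ d).1 hD.2
      have := h.E4G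
      have := h.E14
      tauto
    subst hd
    have hmd := h.E34
    have iH : ∀ w, R.I w H ↔ w = e₁ ∨ w = e₄ ∨ w = m := h.fac3
    have iD : ∀ w, R.I w D ↔ w = e₁ ∨ w = m ∨ w = d := h.fac4
    have : H' = D := by
      rcases (h.vert H').1 h1' with rfl | rfl | rfl | h
      · exact absurd rfl hH'
      · exact absurd rfl hHG₁
      · simpa [hq.E12.symm, hq.E24, hmd.symm] using (iH d).1 h2'
      · exact h
    subst this
    exact ⟨m, h.E3G, h.E23.symm, hmd, iH, iD⟩

/-- The facet `H` lies behind two consecutive edges of the link of `v`. If it contains `e₃`, it is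
the base of a pyramid. Otherwise `corner` at `e₂` makes it the triangle `e₁ e₂ e₄` next to `e₂ e₃
e₄`, which gives a bisimplex with apices `e₁`, `e₃`. -/
theorem hasTable_of_glued (hs : R.HasSqrt) {v e₁ e₂ e₃ e₄ : V} {G₁ G₂ G₃ G₄ H : F}
    (hq : IsQuad R.dual.I v G₁ G₂ G₃ G₄ e₁ e₂ e₃ e₄) (hv : ¬ R.I v H) (h4 : R.I e₄ H)
    (h1 : R.I e₁ H) (h2 : R.I e₂ H) :
    HasTable R.I pyramidTable ∨ HasTable R.I bisimplexTable := by
  have hvG : ∀ K, R.I v K ↔ K = G₁ ∨ K = G₂ ∨ K = G₃ ∨ K = G₄ := hq.vert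
  have iG₁ : ∀ w, R.I w G₁ ↔ w = v ∨ w = e₄ ∨ w = e₁ := hq.fac1
  have iG₂ : ∀ w, R.I w G₂ ↔ w = v ∨ w = e₁ ∨ w = e₂ := hq.fac2
  have iG₃ : ∀ w, R.I w G₃ ↔ w = v ∨ w = e₂ ∨ w = e₃ := hq.fac3
  have iG₄ : ∀ w, R.I w G₄ ↔ w = v ∨ w = e₃ ∨ w = e₄ := hq.fac4
  have a1 := hq.E1G
  have a2 := hq.E2G
  have a3 := hq.E3G
  have a4 := hq.E4G
  have b12 := hq.E12
  have b13 := hq.E13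
  have b14 := hq.E14
  have b23 := hq.E23
  have b24 := hq.E24
  have b34 := hq.E34
  by_cases h3 : R.I e₃ H
  · left
    refine R.hasTable_of_table isClosedTable_pyramid ![v, e₁, e₂, e₃, e₄] ![G₁, G₂, G₃, G₄, H] ?_
    simp [Fin.forall_fin_succ, pyramidTable, iG₁, iG₂, iG₃, iG₄, hv, h1, h2, h3, h4, a1, a2, a3, a4,
      b12, b13, b14, b23, b24, b34, b12.symm, b13.symm, b14.symm, b23.symm, b24.symm, b34.symm]
  · right
    obtain ⟨c, C, hf⟩ := R.flag_with (u := e₂) (w := v) (G := G₃) (H := G₂) (by simp [iG₃])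
      (by simp [iG₃]) (by simp [iG₂]) (by simp [iG₂]) hq.E2G.symm hq.v23
    have hc : c = e₃ := by
      have := (iG₃ c).1 hf.bG
      have := hf.ab
      have := hf.bv
      tauto
    subst hc
    have hHG : H ≠ G₂ := by
      rintro rfl
      exact hv (by simp [iG₂])
    rcases corner hs hq.rotate hHG h1 h2 hf.BG hf.vB hf.bB with rfl | ⟨m, m2, m1, m3, iH, iC⟩
    · exact absurd hf.bB h3
    · have hm : m = e₄ := by
        have := (iH e₄).1 h4
        grind
      subst hm
      refine R.hasTable_of_table isClosedTable_bisimplex ![v, e₁, e₂, c, m]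
        ![G₁, G₂, G₃, G₄, H, C] ?_
      simp [Fin.forall_fin_succ, bisimplexTable, iG₁, iG₂, iG₃, iG₄, iH, iC, a1, a2, a3, a4,
        b12, b13, b14, b23, b24, b34, b12.symm, b13.symm, b14.symm, b23.symm, b24.symm, b34.symm,
        a1.symm, a2.symm, a3.symm, a4.symm]

/-- If no two consecutive facets behind the link coincide in the three comparisons made, all four
are triangles with a common third vertex, the one opposite to `v` in an octahedron. -/
theorem hasTable_of_degree_four (hs : R.HasSqrt) {v e₁ e₂ e₃ e₄ : V} {G₁ G₂ G₃ G₄ : F}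
    (hq : IsQuad R.dual.I v G₁ G₂ G₃ G₄ e₁ e₂ e₃ e₄) :
    HasTable R.I pyramidTable ∨ HasTable R.I bisimplexTable ∨ HasTable R.I octahedronTable := by
  obtain ⟨H₁, H1G, H14, H11, H1v⟩ := exists_facet_behind hq
  obtain ⟨H₂, H2G, H21, H22, H2v⟩ := exists_facet_behind hq.rotate
  obtain ⟨H₃, H3G, H32, H33, H3v⟩ := exists_facet_behind hq.rotate.rotate
  obtain ⟨H₄, H4G, H43, H44, H4v⟩ := exists_facet_behind hq.rotate.rotate.rotate
  rw [← or_assoc]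
  rcases corner hs hq H1G H14 H11 H2G H21 H22 with rfl | ⟨c₁, c11, c14, c12, i1, i2⟩
  · exact Or.inl (hasTable_of_glued hs hq H1v H14 H11 H22)
  rcases corner hs hq.rotate H2G H21 H22 H3G H32 H33 with rfl | ⟨c₂, c22, c21, c23, i2', i3⟩
  · exact Or.inl (hasTable_of_glued hs hq.rotate H2v H21 H22 H33)
  rcases corner hs hq.rotate.rotate H3G H32 H33 H4G H43 H44 with rfl | ⟨c₃, c33, c32, c34, i3', i4⟩
  · exact Or.inl (hasTable_of_glued hs hq.rotate.rotate H3v H32 H33 H44)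
  right
  have hc₂ : c₂ = c₁ := by
    have := (i2' c₁).1 ((i2 c₁).2 (by tauto))
    grind
  have hc₃ : c₃ = c₂ := by
    have := (i3' c₂).1 ((i3 c₂).2 (by tauto))
    grind
  subst hc₃ hc₂
  have hcv : c₃ ≠ v := fun h => H1v (h ▸ (i1 c₃).2 (by tauto))
  have iG₁ : ∀ w, R.I w G₁ ↔ w = v ∨ w = e₄ ∨ w = e₁ := hq.fac1
  have iG₂ : ∀ w, R.I w G₂ ↔ w = v ∨ w = e₁ ∨ w = e₂ := hq.fac2
  have iG₃ : ∀ w, R.I w G₃ ↔ w = v ∨ w = e₂ ∨ w = e₃ := hq.fac3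
  have iG₄ : ∀ w, R.I w G₄ ↔ w = v ∨ w = e₃ ∨ w = e₄ := hq.fac4
  have a1 := hq.E1G
  have a2 := hq.E2G
  have a3 := hq.E3G
  have a4 := hq.E4G
  have b12 := hq.E12
  have b13 := hq.E13
  have b14 := hq.E14
  have b23 := hq.E23
  have b24 := hq.E24
  have b34 := hq.E34
  refine R.hasTable_of_table isClosedTable_octahedron ![v, e₁, e₂, e₃, e₄, c₃]
    ![G₁, G₂, G₃, G₄, H₁, H₂, H₃, H₄] ?_
  simp [Fin.forall_fin_succ, octahedronTable, iG₁, iG₂, iG₃, iG₄, i1, i2, i3, i4, a1, a2, a3, a4,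
    b12, b13, b14, b23, b24, b34, b12.symm, b13.symm, b14.symm, b23.symm, b24.symm, b34.symm,
    a1.symm, a2.symm, a3.symm, a4.symm, hcv, hcv.symm, c11, c12, c33, c34, c11.symm, c12.symm,
    c33.symm, c34.symm]

/-- The combinatorial classification of psd-minimal polytopes of dimension three. -/
theorem classification [Nonempty V] (hs : R.HasSqrt) :
    HasTable R.I simplexTable ∨
    (HasTable R.I pyramidTable ∨ HasTable R.I bisimplexTable ∨ HasTable R.I octahedronTable) ∨
    (HasTable R.dual.I pyramidTable ∨ HasTable R.dual.I bisimplexTable ∨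
      HasTable R.dual.I octahedronTable) := by
  by_cases hG : ∀ G, R.IsTriangle G
  · by_cases hv : ∀ v, R.dual.IsTriangle v
    · exact Or.inl (hasTable_simplex hG hv)
    · push Not at hv
      obtain ⟨v, hv⟩ := hv
      obtain ⟨_, _, _, _, _, _, _, _, hq⟩ := (isTriangle_or_isQuad hs.dual v).resolve_left hv
      exact Or.inr (Or.inl (hasTable_of_degree_four hs hq))
  · push Not at hG
    obtain ⟨G, hG⟩ := hG
    obtain ⟨_, _, _, _, _, _, _, _, hq⟩ := (isTriangle_or_isQuad hs G).resolve_left hG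
    exact Or.inr (Or.inr (hasTable_of_degree_four (R := R.dual) hs.dual hq))

end PolyRep

/-! ### Flags of a polytope in homogeneous coordinates -/

theorem exists_functional {U : Submodule ℝ (Fin 4 → ℝ)} {x : Fin 4 → ℝ} (hx : x ∉ U) :
    ∃ k : Fin 4 → ℝ, (∀ u ∈ U, u ⬝ᵥ k = 0) ∧ x ⬝ᵥ k = 1 := by
  obtain ⟨l, hl, hU⟩ := Submodule.exists_le_ker_of_notMem hx
  have key : ∀ u, u ⬝ᵥ (dotProductEquiv ℝ (Fin 4)).symm l = l u := fun u => by
    conv_rhs => rw [← (dotProductEquiv ℝ (Fin 4)).apply_symm_apply l]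
    rw [dotProduct_comm]
    rfl
  refine ⟨(l x)⁻¹ • (dotProductEquiv ℝ (Fin 4)).symm l, fun u hu => ?_, ?_⟩
  · rw [dotProduct_smul, key, LinearMap.mem_ker.1 (hU hu), smul_zero]
  · rw [dotProduct_smul, key, smul_eq_mul, inv_mul_cancel₀ hl]

theorem finrank_span_pair_le (x y : Fin 4 → ℝ) :
    Module.finrank ℝ (Submodule.span ℝ {x, y}) ≤ 2 := by
  have h1 := finrank_range_le_card (R := ℝ) ![x, y]
  have h2 : Set.range ![x, y] = {x, y} := by
    rw [Matrix.range_cons, Matrix.range_cons, Matrix.range_empty, Set.union_empty]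
    rfl
  rwa [h2, Fintype.card_fin] at h1

theorem le_finrank_of_triangular {W : Type*} [AddCommGroup W] [Module ℝ W]
    [FiniteDimensional ℝ W] {r : ℕ} {q : Fin r → W} {g : Fin r → W →ₗ[ℝ] ℝ}
    (hd : ∀ i, g i (q i) ≠ 0) (hu : ∀ i j, i < j → g j (q i) = 0) {U : Submodule ℝ W}
    (hq : ∀ i, q i ∈ U) : r ≤ Module.finrank ℝ U := by
  have hli : LinearIndependent ℝ q := by
    rw [Fintype.linearIndependent_iff]
    intro c hc
    let N : Matrix (Fin r) (Fin r) ℝ := Matrix.of fun i j => g j (q i)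
    have hdet : N.det ≠ 0 := by
      rw [Matrix.det_of_isLowerTriangular]
      · exact Finset.prod_ne_zero_iff.mpr fun i _ => hd i
      · intro i j hij
        exact hu i j hij
    refine congrFun (Matrix.eq_zero_of_vecMul_eq_zero hdet (funext fun j => ?_))
    have := congrArg (g j) hc
    simpa [map_sum, vecMul, dotProduct, N] using this
  have h1 : Submodule.span ℝ (Set.range q) ≤ U := by
    rw [Submodule.span_le]
    rintro _ ⟨i, rfl⟩
    exact hq i
  have h2 := Submodule.finrank_mono h1
  rwa [finrank_span_eq_card hli, Fintype.card_fin] at h2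

theorem three_le_finrank {q g : Fin 3 → Fin 4 → ℝ} (hd : ∀ i, q i ⬝ᵥ g i ≠ 0)
    (hu : ∀ i j, i < j → q i ⬝ᵥ g j = 0) {U : Submodule ℝ (Fin 4 → ℝ)} (hq : ∀ i, q i ∈ U) :
    3 ≤ Module.finrank ℝ U :=
  le_finrank_of_triangular (g := fun i => dotProductEquiv ℝ (Fin 4) (g i))
    (fun i => by simpa [dotProduct_comm] using hd i)
    (fun i j hij => by simpa [dotProduct_comm] using hu i j hij) hq

theorem finrank_zeros_le {V : Type*} {p : V → Fin 4 → ℝ} {g : Fin 4 → ℝ} {w : V}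
    (hw : p w ⬝ᵥ g ≠ 0) :
    Module.finrank ℝ (Submodule.span ℝ (p '' {v | p v ⬝ᵥ g = 0})) ≤ 3 := by
  have : Submodule.span ℝ (p '' {v | p v ⬝ᵥ g = 0}) ≠ ⊤ := by
    intro htop
    have hmem : p w ∈ Submodule.span ℝ (p '' {v | p v ⬝ᵥ g = 0}) := htop ▸ Submodule.mem_top
    refine hw ?_
    generalize p w = x at hmem
    induction hmem using Submodule.span_induction with
    | mem x hx => obtain ⟨v, hv, rfl⟩ := hx; exact hv
    | zero => exact zero_dotProduct _
    | add x y _ _ hx hy => rw [add_dotProduct, hx, hy, add_zero]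
    | smul c x _ hx => rw [smul_dotProduct, hx, smul_zero]
  have := Submodule.finrank_lt this
  rw [Module.finrank_fin_fun] at this
  omega

/-- The points `p v` are the vertices of a three-dimensional polytope in homogeneous coordinates,
and the functionals `f G` are its facets. -/
structure IsFacetSystem {V F : Type*} (I : V → F → Prop) (p : V → Fin 4 → ℝ)
    (f : F → Fin 4 → ℝ) (h : Fin 4 → ℝ) : Prop where
  height : ∀ v, p v ⬝ᵥ h = 1
  nonneg : ∀ v G, 0 ≤ p v ⬝ᵥ f G
  zero_iff : ∀ v G, p v ⬝ᵥ f G = 0 ↔ I v G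
  span : Submodule.span ℝ (Set.range p) = ⊤
  rank : ∀ G, Module.finrank ℝ (Submodule.span ℝ (p '' {v | I v G})) = 3
  complete : ∀ g, (∀ v, 0 ≤ p v ⬝ᵥ g) →
    Module.finrank ℝ (Submodule.span ℝ (p '' {v | p v ⬝ᵥ g = 0})) = 3 →
    ∃ G, ∀ v, I v G ↔ p v ⬝ᵥ g = 0
  ext : ∀ G H, (∀ v, I v G ↔ I v H) → G = H
  exposed : ∀ v, ∃ g, p v ⬝ᵥ g = 0 ∧ ∀ w, w ≠ v → 0 < p w ⬝ᵥ g

namespace IsFacetSystem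
variable {V F : Type*} {I : V → F → Prop} {p : V → Fin 4 → ℝ} {f : F → Fin 4 → ℝ}
  {h : Fin 4 → ℝ}

theorem exists_not_mem (S : IsFacetSystem I p f h) (G : F) : ∃ w, ¬ I w G := by
  by_contra! hall
  have h1 := S.rank G
  have : {v | I v G} = Set.univ := Set.eq_univ_of_forall hall
  rw [this, Set.image_univ, S.span, finrank_top, Module.finrank_fin_fun] at h1
  omega

theorem exists_mem_not_mem_span (S : IsFacetSystem I p f h) (G : F) (x y : Fin 4 → ℝ) :
    ∃ w, I w G ∧ p w ∉ Submodule.span ℝ {x, y} := by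
  by_contra! hall
  have h1 : Submodule.span ℝ (p '' {v | I v G}) ≤ Submodule.span ℝ {x, y} := by
    rw [Submodule.span_le]
    rintro _ ⟨w, hw, rfl⟩
    exact hall w hw
  have h2 := Submodule.finrank_mono h1
  have h3 := finrank_span_pair_le x y
  rw [S.rank G] at h2
  omega

/-- If `w ≠ a` lay on one ray from `v`, the nearer one would be between `v` and the other. The
functional exposing `w` excludes this for `γ ≥ 0`, the one exposing `a` for `γ < 0`. -/
theorem eq_of_mem_ray (S : IsFacetSystem I p f h) {v w a : V} (hwv : w ≠ v)
    {α β γ : ℝ} (hα : 0 < α) (hβ : 0 < β) (heq : α • p w = β • p a + γ • p v) : w = a := by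
  by_contra hwa
  obtain ⟨e, ew, ew'⟩ := S.exposed w
  obtain ⟨d, da, da'⟩ := S.exposed a
  have h1 := congrArg (· ⬝ᵥ e) heq
  have h2 := congrArg (· ⬝ᵥ d) heq
  simp only [add_dotProduct, smul_dotProduct, smul_eq_mul, ew, da, mul_zero, zero_add] at h1 h2
  have e1 := ew' a (Ne.symm hwa)
  have e2 := ew' v hwv.symm
  have e3 := da' w hwa
  have e4 : 0 ≤ p v ⬝ᵥ d := by
    by_cases hva : v = a
    · rw [hva, da]
    · exact (da' v hva).le
  have h3 : 0 < β * p a ⬝ᵥ e := by positivity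
  have h4 : 0 < α * p w ⬝ᵥ d := by positivity
  rcases le_or_gt 0 γ with hγ | hγ
  · have : 0 ≤ γ * p v ⬝ᵥ e := by positivity
    linarith
  · nlinarith

/-- Rotating the hyperplane of a facet around an edge until it meets another facet. -/
theorem exists_adjacent [Finite V] (S : IsFacetSystem I p f h) {G : F} {v a : V} (vG : I v G)
    (aG : I a G) (hav : a ≠ v) {g : Fin 4 → ℝ} (hg : ∀ w, I w G → 0 ≤ p w ⬝ᵥ g)
    (hg0 : ∀ w, I w G → (p w ⬝ᵥ g = 0 ↔ w = v ∨ w = a)) :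
    ∃ A w₀, ¬ I w₀ G ∧ I w₀ A ∧ ∀ w, I w G → (I w A ↔ w = v ∨ w = a) := by
  have fpos : ∀ {w}, ¬ I w G → 0 < p w ⬝ᵥ f G := fun {w} hw =>
    lt_of_le_of_ne (S.nonneg w G) fun h0 => hw ((S.zero_iff w G).1 h0.symm)
  -- The value `r` at `w₀` is the least multiple of `f G` that makes `g + r • f G` nonnegative off
  -- `G`. On `G` nothing changes, and `w₀` becomes the third independent zero besides `v` and `a`.
  obtain ⟨w₀, hw₀, hmax⟩ := Set.exists_max_image {w | ¬ I w G}
    (fun w => -(p w ⬝ᵥ g) / (p w ⬝ᵥ f G)) (Set.toFinite _) (S.exists_not_mem G)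
  simp only [Set.mem_ofPred_eq] at hw₀ hmax
  set r := -(p w₀ ⬝ᵥ g) / (p w₀ ⬝ᵥ f G) with hr
  have hval : ∀ w, I w G → p w ⬝ᵥ (g + r • f G) = p w ⬝ᵥ g := fun w hw => by
    rw [dotProduct_add, dotProduct_smul, (S.zero_iff w G).2 hw, smul_zero, add_zero]
  have h0 : p w₀ ⬝ᵥ (g + r • f G) = 0 := by
    rw [dotProduct_add, dotProduct_smul, hr, smul_eq_mul, div_mul_cancel₀ _ (fpos hw₀).ne',
      add_neg_cancel]
  obtain ⟨b, bG, hb⟩ := S.exists_mem_not_mem_span G (p v) (p a)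
  have hb0 : p b ⬝ᵥ (g + r • f G) ≠ 0 := by
    rw [hval b bG, ne_eq, hg0 b bG]
    rintro (rfl | rfl)
    · exact hb (Submodule.subset_span (by simp))
    · exact hb (Submodule.subset_span (by simp))
  obtain ⟨e, ev, ev'⟩ := S.exposed v
  obtain ⟨A, hA⟩ := S.complete (g + r • f G) (by
    intro w
    by_cases hw : I w G
    · rw [hval w hw]
      exact hg w hw
    · have := hmax w hw
      rw [div_le_iff₀ (fpos hw)] at this
      rw [dotProduct_add, dotProduct_smul, smul_eq_mul]
      linarith) (by
    refine le_antisymm (finrank_zeros_le hb0) ?_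
    refine three_le_finrank (q := ![p v, p a, p w₀]) (g := ![h, e, f G]) ?_ ?_ ?_
    · simp [Fin.forall_fin_succ, S.height, (ev' a hav).ne', (fpos hw₀).ne']
    · simp [Fin.forall_fin_succ, ev, (S.zero_iff _ _).2 vG, (S.zero_iff _ _).2 aG]
    · have : ∀ w, p w ⬝ᵥ (g + r • f G) = 0 →
        p w ∈ Submodule.span ℝ (p '' {v | p v ⬝ᵥ (g + r • f G) = 0}) := fun w hw =>
          Submodule.subset_span ⟨w, hw, rfl⟩
      simp only [Fin.forall_fin_succ]
      refine ⟨this v ?_, this a ?_, this w₀ h0, fun i => i.elim0⟩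
      · rw [hval v vG, hg0 v vG]; simp
      · rw [hval a aG, hg0 a aG]; simp)
  refine ⟨A, w₀, hw₀, (hA w₀).2 h0, fun w hw => ?_⟩
  rw [hA, hval w hw, hg0 w hw]

/-- An edge lies in only two facets. -/
theorem eq_or_eq_of_edge (S : IsFacetSystem I p f h) {G A H : F} {v a b w₀ : V} (hav : a ≠ v)
    (hGA : ∀ w, I w G → (I w A ↔ w = v ∨ w = a)) (vG : I v G) (aG : I a G) (bG : I b G)
    (bA : ¬ I b A) (wG : ¬ I w₀ G) (wA : I w₀ A) (vH : I v H) (aH : I a H) : H = G ∨ H = A := by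
  have fpos : ∀ {w G}, ¬ I w G → 0 < p w ⬝ᵥ f G := fun {w G} hw =>
    lt_of_le_of_ne (S.nonneg w G) fun h0 => hw ((S.zero_iff w G).1 h0.symm)
  have vA : I v A := (hGA v vG).2 (by simp)
  have aA : I a A := (hGA a aG).2 (by simp)
  obtain ⟨e, ev, ev'⟩ := S.exposed v
  set α := (p w₀ ⬝ᵥ f H) / (p w₀ ⬝ᵥ f G) with hα
  set β := (p b ⬝ᵥ f H) / (p b ⬝ᵥ f A) with hβ
  have z := fun w G => S.zero_iff w G
  -- Functionals vanishing at `v` and `a` form a plane spanned by `f G` and `f A`; `w₀` and `b` read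
  -- off the coefficients. Both are nonnegative, and if both were positive, `H` would meet the
  -- vertices only in `G ∩ A = {v, a}`, too few for a facet.
  have hx : f H = α • f G + β • f A := by
    rw [← sub_eq_zero]
    refine eq_zero_of_triangular (q := ![f G, f A, e, h]) (g := ![p w₀, p b, p a, p v]) ?_ ?_ ?_
    · simp [Fin.forall_fin_succ, dotProduct_comm _ (p _), S.height, (fpos wG).ne', (fpos bA).ne',
        (ev' a hav).ne']
    · simp [Fin.forall_fin_succ, dotProduct_comm _ (p _), z, ev, bG, aG, vG, aA, vA]
    · simp [Fin.forall_fin_succ, dotProduct_comm _ (p _),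
        (z _ _).2 bG, (z _ _).2 aG, (z _ _).2 vG, (z _ _).2 aA, (z _ _).2 vA, (z _ _).2 aH,
        (z _ _).2 vH, (z _ _).2 wA, hα, hβ, (fpos wG).ne', (fpos bA).ne']
  have hα0 : 0 ≤ α := div_nonneg (S.nonneg _ _) (S.nonneg _ _)
  have hβ0 : 0 ≤ β := div_nonneg (S.nonneg _ _) (S.nonneg _ _)
  have hval : ∀ w, p w ⬝ᵥ f H = α * (p w ⬝ᵥ f G) + β * (p w ⬝ᵥ f A) := fun w => by
    rw [hx, dotProduct_add, dotProduct_smul, dotProduct_smul, smul_eq_mul, smul_eq_mul]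
  obtain ⟨u, hu⟩ := S.exists_not_mem H
  rw [← z, hval] at hu
  rcases hα0.eq_or_lt with hα1 | hα1
  · right
    have hβ1 : β ≠ 0 := fun h0 => hu (by rw [← hα1, h0, zero_mul, zero_mul, add_zero])
    refine S.ext _ _ fun w => ?_
    rw [← z, hval, ← hα1, zero_mul, zero_add, mul_eq_zero, or_iff_right hβ1, z]
  · rcases hβ0.eq_or_lt with hβ1 | hβ1
    · left
      refine S.ext _ _ fun w => ?_
      rw [← z, hval, ← hβ1, zero_mul, add_zero, mul_eq_zero, or_iff_right hα1.ne', z]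
    · exfalso
      obtain ⟨w, wH, hw⟩ := S.exists_mem_not_mem_span H (p v) (p a)
      have h0 := (z _ _).2 wH
      have h1 := S.nonneg w G
      have h2 := S.nonneg w A
      rw [hval] at h0
      have h3 : p w ⬝ᵥ f G = 0 := by
        by_contra h4
        have : 0 < p w ⬝ᵥ f G := lt_of_le_of_ne h1 (Ne.symm h4)
        have : 0 < α * (p w ⬝ᵥ f G) := by positivity
        have : 0 ≤ β * (p w ⬝ᵥ f A) := by positivity
        linarith
      have h4 : p w ⬝ᵥ f A = 0 := by
        rw [h3, mul_zero, zero_add] at h0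
        exact (mul_eq_zero.1 h0).resolve_left hβ1.ne'
      rcases (hGA w ((z _ _).1 h3)).1 ((z _ _).1 h4) with rfl | rfl
      · exact hw (Submodule.subset_span (by simp))
      · exact hw (Submodule.subset_span (by simp))

/-- Seen from `v`, the other vertices of `G` are ordered by the slope `k / e`, where `e` exposes
`v`. The extreme slopes are attained by the two neighbours. Any other vertex of `G` lies strictly
between them, so only `G` contains both it and `v`. -/
theorem exists_flag [Finite V] (S : IsFacetSystem I p f h) {v : V} {G : F} (vG : I v G) :
    ∃ a b A B, IsFlag I v G a b A B := by
  have z := fun w G => S.zero_iff w G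
  obtain ⟨w₀, hw₀⟩ := S.exists_not_mem G
  obtain ⟨w₁, w₁G, h₁⟩ := S.exists_mem_not_mem_span G (p v) (p v)
  obtain ⟨w₂, w₂G, h₂⟩ := S.exists_mem_not_mem_span G (p v) (p w₁)
  obtain ⟨k, hk, hk₂⟩ := exists_functional h₂
  have kv : p v ⬝ᵥ k = 0 := hk _ (Submodule.subset_span (by simp))
  have kw₁ : p w₁ ⬝ᵥ k = 0 := hk _ (Submodule.subset_span (by simp))
  have hw₁v : w₁ ≠ v := by
    rintro rfl
    exact h₁ (Submodule.subset_span (by simp))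
  obtain ⟨e, ev, ev'⟩ := S.exposed v
  -- Equal slopes mean that a combination of the two vertices is killed by `f G`, `e` and `k`, hence
  -- is a multiple of `p v`; the vertices are then on one ray from `v`.
  have hK : ∀ x, x ⬝ᵥ f G = 0 → x ⬝ᵥ e = 0 → x ⬝ᵥ k = 0 → x = (x ⬝ᵥ h) • p v := by
    intro x xG xe xk
    rw [← sub_eq_zero]
    refine eq_zero_of_triangular (q := ![p v, p w₁, p w₂, p w₀]) (g := ![h, e, k, f G]) ?_ ?_ ?_
    · simp [Fin.forall_fin_succ, S.height, (ev' w₁ hw₁v).ne', hk₂, z, hw₀]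
    · simp [Fin.forall_fin_succ, z, vG, w₁G, w₂G, ev, kv, kw₁]
    · simp [Fin.forall_fin_succ, (z _ _).2 vG, ev, kv, xG, xe, xk, S.height]
  have hray : ∀ w a, I w G → I a G → w ≠ v → a ≠ v →
      (p w ⬝ᵥ k) / (p w ⬝ᵥ e) = (p a ⬝ᵥ k) / (p a ⬝ᵥ e) → w = a := by
    intro w a wG aG wv av heq
    have e1 := ev' w wv
    have e2 := ev' a av
    rw [div_eq_div_iff e1.ne' e2.ne'] at heq
    have hx := hK ((p a ⬝ᵥ e) • p w - (p w ⬝ᵥ e) • p a)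
      (by simp [(z _ _).2 wG, (z _ _).2 aG])
      (by simp only [sub_dotProduct, smul_dotProduct, smul_eq_mul]; ring)
      (by simp only [sub_dotProduct, smul_dotProduct, smul_eq_mul]; linarith)
    rw [sub_eq_iff_eq_add, add_comm] at hx
    exact S.eq_of_mem_ray wv e2 e1 hx
  have hne : {w | I w G ∧ w ≠ v}.Nonempty := ⟨w₁, w₁G, hw₁v⟩
  obtain ⟨a, ⟨aG, av⟩, hmin⟩ := Set.exists_min_image {w | I w G ∧ w ≠ v}
    (fun w => (p w ⬝ᵥ k) / (p w ⬝ᵥ e)) (Set.toFinite _) hne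
  obtain ⟨b, ⟨bG, bv⟩, hmax⟩ := Set.exists_max_image {w | I w G ∧ w ≠ v}
    (fun w => (p w ⬝ᵥ k) / (p w ⬝ᵥ e)) (Set.toFinite _) hne
  have hab : a ≠ b := by
    rintro rfl
    have : ∀ w, I w G → w ≠ v → w = a := fun w wG wv =>
      hray w a wG aG wv av (le_antisymm (hmax w ⟨wG, wv⟩) (hmin w ⟨wG, wv⟩))
    have e1 := this w₁ w₁G hw₁v
    have hw₂v : w₂ ≠ v := by
      rintro rfl
      exact h₂ (Submodule.subset_span (by simp))
    have e2 := this w₂ w₂G hw₂v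
    rw [← e1] at e2
    subst e2
    exact h₂ (Submodule.subset_span (by simp))
  set s := (p a ⬝ᵥ k) / (p a ⬝ᵥ e) with hs
  set t := (p b ⬝ᵥ k) / (p b ⬝ᵥ e) with ht
  have hka : ∀ w, w ≠ v → p w ⬝ᵥ (k - s • e) = (p w ⬝ᵥ e) * ((p w ⬝ᵥ k) / (p w ⬝ᵥ e) - s) := by
    intro w wv
    have := (ev' w wv).ne'
    simp only [dotProduct_sub, dotProduct_smul, smul_eq_mul]
    field_simp
  have hkb : ∀ w, w ≠ v → p w ⬝ᵥ (t • e - k) = (p w ⬝ᵥ e) * (t - (p w ⬝ᵥ k) / (p w ⬝ᵥ e)) := by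
    intro w wv
    have := (ev' w wv).ne'
    simp only [dotProduct_sub, dotProduct_smul, smul_eq_mul]
    field_simp
  obtain ⟨A, wA, hwA, hwA', hA⟩ := S.exists_adjacent vG aG av (g := k - s • e) (by
      intro w wG
      by_cases wv : w = v
      · simp [wv, kv, ev]
      · rw [hka w wv]
        exact mul_nonneg (ev' w wv).le (sub_nonneg.2 (hmin w ⟨wG, wv⟩))) (by
      intro w wG
      by_cases wv : w = v
      · simp [wv, kv, ev]
      · rw [hka w wv, mul_eq_zero, or_iff_right (ev' w wv).ne', or_iff_right wv, sub_eq_zero]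
        exact ⟨hray w a wG aG wv av, fun h => by rw [h]⟩)
  obtain ⟨B, wB, hwB, hwB', hB⟩ := S.exists_adjacent vG bG bv (g := t • e - k) (by
      intro w wG
      by_cases wv : w = v
      · simp [wv, kv, ev]
      · rw [hkb w wv]
        exact mul_nonneg (ev' w wv).le (sub_nonneg.2 (hmax w ⟨wG, wv⟩))) (by
      intro w wG
      by_cases wv : w = v
      · simp [wv, kv, ev]
      · rw [hkb w wv, mul_eq_zero, or_iff_right (ev' w wv).ne', or_iff_right wv, sub_eq_zero]
        exact ⟨fun h => hray w b wG bG wv bv h.symm, fun h => by rw [h]⟩)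
  have aA : I a A := (hA a aG).2 (by simp)
  have vA : I v A := (hA v vG).2 (by simp)
  have bB : I b B := (hB b bG).2 (by simp)
  have vB : I v B := (hB v vG).2 (by simp)
  have bA : ¬ I b A := by simp [hA b bG, bv, hab.symm]
  have aB : ¬ I a B := by simp [hB a aG, av, hab]
  have AG : A ≠ G := by
    rintro rfl
    exact bA bG
  have BG : B ≠ G := by
    rintro rfl
    exact aB aG
  refine ⟨a, b, A, B, vG, aG, bG, vA, vB, av, bv, hab, AG, BG, fun h => bA (h ▸ bB), ?_⟩
  intro w H wG vH
  constructor
  swap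
  · rintro (rfl | rfl | ⟨rfl, rfl⟩ | ⟨rfl, rfl⟩)
    exacts [vH, wG, aA, bB]
  intro wH
  by_cases wv : w = v
  · exact Or.inl wv
  by_cases HG : H = G
  · exact Or.inr (Or.inl HG)
  right
  right
  by_cases wa : w = a
  · subst wa
    exact Or.inl ⟨rfl, (S.eq_or_eq_of_edge av hA vG aG bG bA hwA hwA' vH wH).resolve_left HG⟩
  by_cases wb : w = b
  · subst wb
    exact Or.inr ⟨rfl, (S.eq_or_eq_of_edge bv hB vG bG aG aB hwB hwB' vH wH).resolve_left HG⟩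
  exfalso
  -- Modulo `p v`, the vertex `w` is a combination of `a` and `b` with positive coefficients. If `f
  -- H` vanishes at `v` and `w`, it vanishes at `a`, so `H` is `G` or `A`.
  obtain ⟨c, hc⟩ := exists_coords (v := p v) (a := p a) (b := p b) (u := p w₀) (K := h)
    (B := t • e - k) (A := k - s • e) (G := f G) (x := p w) (by simp [S.height]) (by simp [ev, kv])
    (by simp [ev, kv]) ((z _ _).2 vG)
    (by
      rw [hkb a av]
      refine mul_ne_zero (ev' a av).ne' (sub_ne_zero.2 fun h => hab ?_)
      exact (hray b a bG aG bv av h).symm)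
    (by rw [hka a av, sub_self, mul_zero]) ((z _ _).2 aG)
    (by
      rw [hka b bv]
      refine mul_ne_zero (ev' b bv).ne' (sub_ne_zero.2 fun h => hab ?_)
      exact (hray b a bG aG bv av h).symm)
    (by rw [hkb b bv, sub_self, mul_zero]) ((z _ _).2 bG) (fun h0 => hw₀ ((z _ _).1 h0))
    ((z _ _).2 wG)
  have hlt1 : s < (p w ⬝ᵥ k) / (p w ⬝ᵥ e) :=
    lt_of_le_of_ne (hmin w ⟨wG, wv⟩) fun h => wa (hray w a wG aG wv av h.symm)
  have hlt2 : (p w ⬝ᵥ k) / (p w ⬝ᵥ e) < t :=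
    lt_of_le_of_ne (hmax w ⟨wG, wv⟩) fun h => wb (hray w b wG bG wv bv h)
  have ew := ev' w wv
  have ea := ev' a av
  have eb := ev' b bv
  have hst : s < t := hlt1.trans hlt2
  rw [hkb w wv, hkb a av, hka w wv, hka b bv] at hc
  have hc' := congrArg (· ⬝ᵥ f H) hc
  simp only [add_dotProduct, smul_dotProduct, smul_eq_mul, (z _ _).2 wH, (z _ _).2 vH, mul_zero,
    zero_add] at hc'
  have c1 : 0 < p w ⬝ᵥ e * (t - p w ⬝ᵥ k / p w ⬝ᵥ e) / (p a ⬝ᵥ e * (t - p a ⬝ᵥ k / p a ⬝ᵥ e)) :=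
    div_pos (mul_pos ew (sub_pos.2 hlt2)) (mul_pos ea (sub_pos.2 hst))
  have c2 : 0 < p w ⬝ᵥ e * (p w ⬝ᵥ k / p w ⬝ᵥ e - s) / (p b ⬝ᵥ e * (p b ⬝ᵥ k / p b ⬝ᵥ e - s)) :=
    div_pos (mul_pos ew (sub_pos.2 hlt1)) (mul_pos eb (sub_pos.2 hst))
  have aH : I a H := by
    rw [← z]
    refine le_antisymm ?_ (S.nonneg a H)
    have := mul_nonneg c2.le (S.nonneg b H)
    by_contra! hlt
    have := mul_pos c1 hlt
    linarith
  exact (S.eq_or_eq_of_edge av hA vG aG bG bA hwA hwA' vH aH).elim HG fun hHA => by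
    subst hHA
    rcases (hA w wG).1 wH with h | h
    exacts [wv h, wa h]

/-- A supporting hyperplane through `v` that contains as many vertices as possible is a facet. -/
theorem exists_facet [Finite V] (S : IsFacetSystem I p f h) (v : V) : ∃ G, I v G := by
  let X : Set (Set V) := {Z | v ∈ Z ∧ ∃ g, (∀ w, 0 ≤ p w ⬝ᵥ g) ∧ (∃ w, p w ⬝ᵥ g ≠ 0) ∧
    Z = {w | p w ⬝ᵥ g = 0}}
  have hX : X.Nonempty := by
    obtain ⟨e, ev, ev'⟩ := S.exposed v
    refine ⟨{w | p w ⬝ᵥ e = 0}, ev, e, fun w => ?_, ?_, rfl⟩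
    · by_cases hw : w = v
      · rw [hw, ev]
      · exact (ev' w hw).le
    · by_contra! hall
      have h1 := S.span
      have h2 : Submodule.span ℝ (Set.range p) ≤ Submodule.span ℝ {p v, p v} := by
        rw [Submodule.span_le]
        rintro _ ⟨w, rfl⟩
        have : w = v := by
          by_contra hw
          exact (ev' w hw).ne' (hall w)
        rw [this]
        exact Submodule.subset_span (by simp)
      have h3 := Submodule.finrank_mono h2
      rw [h1, finrank_top, Module.finrank_fin_fun] at h3
      have := finrank_span_pair_le (p v) (p v)
      omega
  obtain ⟨Z, hZ⟩ := (Set.toFinite X).exists_maximal hX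
  obtain ⟨⟨vZ, g, hg, ⟨w₁, hw₁⟩, rfl⟩, hmax⟩ := hZ
  by_cases h3 : Module.finrank ℝ (Submodule.span ℝ (p '' {w | p w ⬝ᵥ g = 0})) = 3
  · obtain ⟨G, hG⟩ := S.complete g hg h3
    exact ⟨G, (hG v).2 vZ⟩
  exfalso
  have hle := finrank_zeros_le hw₁
  set U := Submodule.span ℝ (p '' {w | p w ⬝ᵥ g = 0}) with hU
  have hU' : Module.finrank ℝ ↥(Submodule.span ℝ {p w₁} ⊔ U) ≤ 3 := by
    have h1 := Submodule.finrank_add_le_finrank_add_finrank (Submodule.span ℝ {p w₁}) U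
    have h2 : Module.finrank ℝ (Submodule.span ℝ {p w₁}) ≤ 1 :=
      (finrank_span_le_card {p w₁}).trans (by simp)
    omega
  obtain ⟨w₂, hw₂⟩ : ∃ w, p w ∉ Submodule.span ℝ {p w₁} ⊔ U := by
    by_contra! hall
    have h1 : Submodule.span ℝ (Set.range p) ≤ Submodule.span ℝ {p w₁} ⊔ U := by
      rw [Submodule.span_le]
      rintro _ ⟨w, rfl⟩
      exact hall w
    have h2 := Submodule.finrank_mono h1
    rw [S.span, finrank_top, Module.finrank_fin_fun] at h2
    omega
  obtain ⟨k, hk, hk2⟩ := exists_functional hw₂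
  have kZ : ∀ w, p w ⬝ᵥ g = 0 → p w ⬝ᵥ k = 0 := fun w hw =>
    hk _ (Submodule.mem_sup_right (Submodule.subset_span ⟨w, hw, rfl⟩))
  have kw₁ : p w₁ ⬝ᵥ k = 0 :=
    hk _ (Submodule.mem_sup_left (Submodule.mem_span_singleton_self _))
  -- The functional `g` is tilted by `k` until a new vertex `u` becomes a zero. Old zeros persist,
  -- and `k` vanishes at `w₁`, so the tilted functional is still nonzero there. This contradicts
  -- maximality.
  obtain ⟨u, hu, hmin⟩ := Set.exists_min_image {w | 0 < p w ⬝ᵥ k}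
    (fun w => (p w ⬝ᵥ g) / (p w ⬝ᵥ k)) (Set.toFinite _) ⟨w₂, by simp [hk2]⟩
  simp only [Set.mem_ofPred_eq] at hu hmin
  set r := (p u ⬝ᵥ g) / (p u ⬝ᵥ k) with hr
  have hr0 : 0 ≤ r := div_nonneg (hg u) hu.le
  have hnew : {w | p w ⬝ᵥ (g - r • k) = 0} ∈ X := by
    refine ⟨?_, g - r • k, fun w => ?_, ⟨w₁, ?_⟩, rfl⟩
    · simp [show p v ⬝ᵥ g = 0 from vZ, kZ v vZ]
    · rw [dotProduct_sub, dotProduct_smul, smul_eq_mul, sub_nonneg]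
      rcases lt_or_ge 0 (p w ⬝ᵥ k) with hw | hw
      · have := hmin w hw
        rwa [le_div_iff₀ hw] at this
      · exact (mul_nonpos_of_nonneg_of_nonpos hr0 hw).trans (hg w)
    · simpa [kw₁] using hw₁
  have hsub : {w | p w ⬝ᵥ g = 0} ≤ {w | p w ⬝ᵥ (g - r • k) = 0} := fun w hw => by
    simp [show p w ⬝ᵥ g = 0 from hw, kZ w hw]
  have hu' : u ∈ {w | p w ⬝ᵥ g = 0} := hmax hnew hsub (by
    simp only [Set.mem_ofPred_eq, dotProduct_sub, dotProduct_smul, smul_eq_mul, hr]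
    field_simp
    ring)
  exact hu.ne' (kZ u hu')

/-- The representation of a polytope by its vertices and facets. -/
def polyRep [Finite V] (S : IsFacetSystem I p f h) : PolyRep V F where
  I := I
  p := p
  f := f
  nonneg := S.nonneg
  zero_iff := S.zero_iff
  flag _ _ hv := S.exists_flag hv
  exists_facet := S.exists_facet
  exists_vertex G := by
    obtain ⟨w, hw, -⟩ := S.exists_mem_not_mem_span G 0 0
    exact ⟨w, hw⟩

end IsFacetSystem

/-! ### From a polytope to its facet system -/

section

variable {n : ℕ} {P : Set (EuclideanSpace ℝ (Fin n))}

theorem IsPolytope.isCompact (hP : IsPolytope P) : IsCompact P := by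
  obtain ⟨s, hs, rfl⟩ := hP
  exact hs.isCompact_convexHull ℝ

theorem IsPolytope.convex (hP : IsPolytope P) : Convex ℝ P := by
  obtain ⟨s, hs, rfl⟩ := hP
  exact convex_convexHull ℝ s

theorem IsPolytope.finite_vertices (hP : IsPolytope P) : (vertices P).Finite := by
  obtain ⟨s, hs, rfl⟩ := hP
  exact hs.subset extremePoints_convexHull_subset

theorem convexHull_extremePoints_eq {A : Set (EuclideanSpace ℝ (Fin n))} (hc : IsCompact A)
    (hA : Convex ℝ A) (hf : (A.extremePoints ℝ).Finite) :
    convexHull ℝ (A.extremePoints ℝ) = A := by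
  have h := closure_convexHull_extremePoints hc hA
  rwa [(hf.isClosed_convexHull ℝ).closure_eq] at h

theorem IsPolytope.convexHull_vertices (hP : IsPolytope P) : convexHull ℝ (vertices P) = P :=
  convexHull_extremePoints_eq hP.isCompact hP.convex hP.finite_vertices

theorem IsPolytope.convexHull_face (hP : IsPolytope P) {A : Set (EuclideanSpace ℝ (Fin n))}
    (hA : IsExposed ℝ P A) : convexHull ℝ (A ∩ vertices P) = A := by
  have h1 : A ∩ vertices P = A.extremePoints ℝ := hA.isExtreme.extremePoints_eq.symm
  rw [h1]
  refine convexHull_extremePoints_eq (hA.isCompact hP.isCompact) (hA.convex hP.convex) ?_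
  rw [← h1]
  exact hP.finite_vertices.subset Set.inter_subset_right

theorem vectorSpan_convexHull (A : Set (EuclideanSpace ℝ (Fin n))) :
    vectorSpan ℝ (convexHull ℝ A) = vectorSpan ℝ A := by
  rw [← direction_affineSpan, affineSpan_convexHull, direction_affineSpan]

/-- Every vertex of a polytope is exposed. -/
theorem IsPolytope.exists_exposing (hP : IsPolytope P) {v : EuclideanSpace ℝ (Fin n)}
    (hv : v ∈ vertices P) : ∃ l : EuclideanSpace ℝ (Fin n) →L[ℝ] ℝ,
      ∀ w ∈ vertices P, w ≠ v → l w < l v := by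
  have hnot : v ∉ convexHull ℝ (vertices P \ {v}) := by
    intro hmem
    have h1 : convexHull ℝ (vertices P \ {v}) = P := by
      refine Set.Subset.antisymm ?_ ?_
      · exact (convexHull_mono Set.sdiff_subset).trans hP.convexHull_vertices.subset
      · conv_lhs => rw [← hP.convexHull_vertices]
        refine convexHull_min (fun w hw => ?_) (convex_convexHull ℝ _)
        by_cases hwv : w = v
        · exact hwv ▸ hmem
        · exact subset_convexHull ℝ _ ⟨hw, hwv⟩
    have h2 : v ∈ (convexHull ℝ (vertices P \ {v})).extremePoints ℝ := by
      rw [h1]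
      exact hv
    exact (extremePoints_convexHull_subset h2).2 rfl
  obtain ⟨l, u, h1, h2⟩ := geometric_hahn_banach_closed_point (convex_convexHull ℝ _)
    ((hP.finite_vertices.subset Set.sdiff_subset).isClosed_convexHull ℝ) hnot
  exact ⟨l, fun w hw hwv => (h1 w (subset_convexHull ℝ _ ⟨hw, hwv⟩)).trans h2⟩

/-- Homogeneous coordinates. -/
def homog (φ : EuclideanSpace ℝ (Fin n) →ₗ[ℝ] (Fin 3 → ℝ)) (x : EuclideanSpace ℝ (Fin n)) :
    Fin 4 → ℝ := Matrix.vecCons 1 (φ x)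

theorem homog_dotProduct (φ : EuclideanSpace ℝ (Fin n) →ₗ[ℝ] (Fin 3 → ℝ))
    (x : EuclideanSpace ℝ (Fin n)) (c : ℝ) (y : Fin 3 → ℝ) :
    homog φ x ⬝ᵥ Matrix.vecCons c y = c + φ x ⬝ᵥ y := by
  rw [homog, Matrix.cons_dotProduct_cons, one_mul]

/-- The span is the direct sum of the line through one homogenised point and the copy of the
direction space at height zero, where `φ` is injective. -/
theorem finrank_span_homog {φ : EuclideanSpace ℝ (Fin n) →ₗ[ℝ] (Fin 3 → ℝ)}
    {A : Set (EuclideanSpace ℝ (Fin n))} (hA : A.Nonempty)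
    (hφ : ∀ x ∈ vectorSpan ℝ A, φ x = 0 → x = 0) :
    Module.finrank ℝ (Submodule.span ℝ (homog φ '' A)) =
      Module.finrank ℝ (vectorSpan ℝ A) + 1 := by
  obtain ⟨x₀, hx₀⟩ := hA
  let ι : EuclideanSpace ℝ (Fin n) →ₗ[ℝ] (Fin 4 → ℝ) :=
    { toFun := fun x => Matrix.vecCons 0 (φ x)
      map_add' := fun x y => by simp
      map_smul' := fun c x => by simp }
  have hι : ∀ x, homog φ x = ι (x - x₀) + homog φ x₀ := fun x => by
    change Matrix.vecCons 1 (φ x) = Matrix.vecCons 0 (φ (x - x₀)) + Matrix.vecCons 1 (φ x₀)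
    simp
  have hspan : Submodule.span ℝ (homog φ '' A) =
      Submodule.span ℝ {homog φ x₀} ⊔ (vectorSpan ℝ A).map ι := by
    have h0 : homog φ x₀ ∈ Submodule.span ℝ (homog φ '' A) := Submodule.subset_span ⟨x₀, hx₀, rfl⟩
    apply le_antisymm
    · rw [Submodule.span_le]
      rintro _ ⟨x, hx, rfl⟩
      have hm : x - x₀ ∈ vectorSpan ℝ A := vsub_mem_vectorSpan ℝ hx hx₀
      have hx' : homog φ x = homog φ x₀ + ι (x - x₀) := by rw [hι x, add_comm]
      rw [hx']
      have hm' := Submodule.mem_map_of_mem (f := ι) hm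
      exact Submodule.add_mem_sup (Submodule.mem_span_singleton_self _) hm'
    · rw [sup_le_iff, Submodule.span_singleton_le_iff_mem]
      refine ⟨h0, ?_⟩
      rw [vectorSpan_eq_span_vsub_set_right ℝ hx₀, Submodule.map_span, Submodule.span_le]
      rintro _ ⟨_, ⟨x, hx, rfl⟩, rfl⟩
      have : ι (x -ᵥ x₀) = homog φ x - homog φ x₀ := by
        rw [hι x, vsub_eq_sub, add_sub_cancel_right]
      simp only [this]
      exact Submodule.sub_mem _ (Submodule.subset_span ⟨x, hx, rfl⟩) h0
  have hdisj : Submodule.span ℝ {homog φ x₀} ⊓ (vectorSpan ℝ A).map ι = ⊥ := by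
    rw [Submodule.eq_bot_iff]
    rintro y ⟨hy1, hy2⟩
    obtain ⟨c, rfl⟩ := Submodule.mem_span_singleton.1 hy1
    obtain ⟨x, -, hx⟩ := hy2
    have := congrFun hx 0
    have hc : 0 = c := by simpa [ι, homog] using this
    rw [← hc, zero_smul]
  have hmap : Module.finrank ℝ ((vectorSpan ℝ A).map ι) = Module.finrank ℝ (vectorSpan ℝ A) := by
    rw [← LinearMap.range_domRestrict]
    apply LinearMap.finrank_range_of_inj
    rw [← LinearMap.ker_eq_bot, Submodule.eq_bot_iff]
    rintro ⟨x, hx⟩ h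
    have h1 : Matrix.vecCons 0 (φ x) = (0 : Fin 4 → ℝ) := h
    refine Subtype.ext (hφ x hx ?_)
    funext i
    exact congrFun h1 i.succ
  have hone : Module.finrank ℝ (Submodule.span ℝ {homog φ x₀}) = 1 := by
    apply finrank_span_singleton
    intro h
    have := congrFun h 0
    simp [homog] at this
  have := Submodule.finrank_sup_add_finrank_inf_eq (Submodule.span ℝ {homog φ x₀})
    ((vectorSpan ℝ A).map ι)
  rw [hdisj, finrank_bot, hmap, hone, ← hspan] at this
  omega

theorem exists_injOn_linearMap (hdim : dim P = 3) :
    ∃ φ : EuclideanSpace ℝ (Fin n) →ₗ[ℝ] (Fin 3 → ℝ),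
      (∀ x ∈ vectorSpan ℝ P, φ x = 0 → x = 0) ∧
      ∀ l : EuclideanSpace ℝ (Fin n) →ₗ[ℝ] ℝ, ∃ y : Fin 3 → ℝ, ∀ x ∈ vectorSpan ℝ P,
        φ x ⬝ᵥ y = l x := by
  let e : vectorSpan ℝ P ≃ₗ[ℝ] (Fin 3 → ℝ) := LinearEquiv.ofFinrankEq _ _ (by
    rw [Module.finrank_fin_fun]
    exact hdim)
  obtain ⟨φ, hφ⟩ := LinearMap.exists_extend (e : vectorSpan ℝ P →ₗ[ℝ] (Fin 3 → ℝ))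
  have hφ' : ∀ x (hx : x ∈ vectorSpan ℝ P), φ x = e ⟨x, hx⟩ := fun x hx =>
    LinearMap.congr_fun hφ ⟨x, hx⟩
  refine ⟨φ, fun x hx h => ?_, fun l => ?_⟩
  · rw [hφ' x hx, LinearEquiv.map_eq_zero_iff] at h
    exact congrArg Subtype.val h
  · refine ⟨(dotProductEquiv ℝ (Fin 3)).symm (l ∘ₗ (vectorSpan ℝ P).subtype ∘ₗ e.symm),
      fun x hx => ?_⟩
    rw [dotProduct_comm]
    change (dotProductEquiv ℝ (Fin 3)) ((dotProductEquiv ℝ (Fin 3)).symm _) (φ x) = _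
    rw [LinearEquiv.apply_symm_apply, hφ' x hx]
    simp

/-- The last clause records that the pairings are the slacks of inequalities valid on `P`; the psd
lift is compared with these. -/
theorem isFacetSystem (hP : IsPolytope P) (hdim : dim P = 3) :
    ∃ (p : vertices P → Fin 4 → ℝ) (f : facets P → Fin 4 → ℝ) (h : Fin 4 → ℝ),
      IsFacetSystem (fun v F => v.1 ∈ F.1) p f h ∧
      ∀ F : facets P, ∃ (l : EuclideanSpace ℝ (Fin n) →ₗ[ℝ] ℝ) (m : ℝ),
        (∀ x ∈ P, l x ≤ m) ∧ ∀ v, p v ⬝ᵥ f F = m - l v := by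
  obtain ⟨φ, hinj, hsurj⟩ := exists_injOn_linearMap hdim
  have hPne : P.Nonempty := by
    rw [Set.nonempty_iff_ne_empty]
    rintro rfl
    rw [dim, vectorSpan_empty, finrank_bot] at hdim
    omega
  have hvP : vertices P ⊆ P := extremePoints_subset
  have hfun : ∀ (l : EuclideanSpace ℝ (Fin n) →ₗ[ℝ] ℝ) (m : ℝ),
      ∃ g, ∀ x ∈ P, homog φ x ⬝ᵥ g = m - l x := by
    intro l m
    obtain ⟨y, hy⟩ := hsurj l
    obtain ⟨x₀, hx₀⟩ := hPne
    refine ⟨Matrix.vecCons (m - l x₀ + φ x₀ ⬝ᵥ y) (-y), fun x hx => ?_⟩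
    have := hy (x - x₀) (vsub_mem_vectorSpan ℝ hx hx₀)
    rw [map_sub, map_sub, sub_dotProduct] at this
    rw [homog_dotProduct, dotProduct_neg]
    linarith
  have hinv : ∀ g : Fin 4 → ℝ, ∃ (l : EuclideanSpace ℝ (Fin n) →L[ℝ] ℝ) (m : ℝ),
      ∀ x, homog φ x ⬝ᵥ g = m - l x := by
    intro g
    refine ⟨LinearMap.toContinuousLinearMap
      ((dotProductEquiv ℝ (Fin 3) (-Matrix.vecTail g)) ∘ₗ φ), Matrix.vecHead g, fun x => ?_⟩
    conv_lhs => rw [← Matrix.cons_head_tail g, homog_dotProduct]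
    simp [dotProduct_comm]
  have hfacet : ∀ F : facets P, ∃ (l : EuclideanSpace ℝ (Fin n) →L[ℝ] ℝ) (m : ℝ),
      (∀ x ∈ P, l x ≤ m) ∧ ∀ x ∈ P, x ∈ F.1 ↔ l x = m := by
    rintro ⟨F, hF, ⟨x₁, hx₁⟩, -⟩
    obtain ⟨l, rfl⟩ := hF ⟨x₁, hx₁⟩
    refine ⟨l, l x₁, hx₁.2, fun x hx => ⟨fun h => le_antisymm (hx₁.2 x hx) (h.2 x₁ hx₁.1),
      fun h => ⟨hx, fun y hy => ?_⟩⟩⟩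
    rw [h]
    exact hx₁.2 y hy
  choose l m hlm hlF using hfacet
  choose f hf using fun F => hfun (l F) (m F)
  have hvs : ∀ A, IsExposed ℝ P A → vectorSpan ℝ (A ∩ vertices P) = vectorSpan ℝ A := by
    intro A hA
    conv_rhs => rw [← hP.convexHull_face hA, vectorSpan_convexHull]
  have hrank : ∀ A : Set (EuclideanSpace ℝ (Fin n)), (A ∩ vertices P).Nonempty →
      Module.finrank ℝ (Submodule.span ℝ ((fun v : vertices P => homog φ v) '' {v | v.1 ∈ A})) =
        Module.finrank ℝ (vectorSpan ℝ (A ∩ vertices P)) + 1 := by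
    intro A hA
    have himg : (fun v : vertices P => homog φ v) '' {v | v.1 ∈ A} =
        homog φ '' (A ∩ vertices P) := by
      ext y
      constructor
      · rintro ⟨v, hv, rfl⟩
        exact ⟨v, ⟨hv, v.2⟩, rfl⟩
      · rintro ⟨v, hv, rfl⟩
        exact ⟨⟨v, hv.2⟩, hv.1, rfl⟩
    rw [himg, ← finrank_span_homog hA (φ := φ)]
    · exact fun x hx => hinj x (vectorSpan_mono ℝ (Set.inter_subset_right.trans hvP) hx)
  have hne : ∀ A, IsExposed ℝ P A → A.Nonempty → (A ∩ vertices P).Nonempty := by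
    intro A hA hA'
    rw [← convexHull_nonempty_iff (𝕜 := ℝ), hP.convexHull_face hA]
    exact hA'
  refine ⟨fun v => homog φ v, f, Matrix.vecCons 1 0, ?_, fun F => ⟨l F, m F, hlm F, fun v => hf F v (hvP v.2)⟩⟩
  constructor
  case height =>
    intro v
    rw [homog_dotProduct, dotProduct_zero, add_zero]
  case nonneg =>
    intro v F
    rw [hf F v (hvP v.2)]
    exact sub_nonneg.2 (hlm F v (hvP v.2))
  case zero_iff =>
    intro v F
    rw [hf F v (hvP v.2), hlF F v (hvP v.2), sub_eq_zero, eq_comm]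
    rfl
  case span =>
    have h1 := hrank P (hne P (IsExposed.refl P) hPne)
    have h2 : {v : vertices P | v.1 ∈ P} = Set.univ := Set.eq_univ_of_forall fun v => hvP v.2
    rw [h2, Set.image_univ, hvs P (IsExposed.refl P)] at h1
    change _ = dim P + 1 at h1
    apply Submodule.eq_top_of_finrank_eq
    rw [h1, hdim, Module.finrank_fin_fun]
  case rank =>
    rintro ⟨A, hA, hA', hd⟩
    change Module.finrank ℝ (Submodule.span ℝ (_ '' {v : vertices P | v.1 ∈ A})) = 3
    rw [hrank A (hne A hA hA'), hvs A hA]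
    change dim A + 1 = 3
    rw [hd, hdim]
  case complete =>
    intro g hg hr
    obtain ⟨l, m, hl⟩ := hinv g
    have hle : ∀ x ∈ P, l x ≤ m := by
      have : convexHull ℝ (vertices P) ⊆ {x | l x ≤ m} := by
        refine convexHull_min (fun v hv => ?_)
          (convex_halfSpace_le (l : EuclideanSpace ℝ (Fin n) →ₗ[ℝ] ℝ).isLinear m)
        have := hg ⟨v, hv⟩
        simp only [hl] at this
        exact sub_nonneg.1 this
      rw [hP.convexHull_vertices] at this
      exact this
    set A := {x ∈ P | l x = m} with hA
    have hZ : {v : vertices P | homog φ v ⬝ᵥ g = 0} = {v : vertices P | v.1 ∈ A} := by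
      ext v
      change homog φ v ⬝ᵥ g = 0 ↔ v.1 ∈ P ∧ l v = m
      rw [hl, sub_eq_zero, eq_comm, and_iff_right (hvP v.2)]
    rw [hZ] at hr
    have hAne : (A ∩ vertices P).Nonempty := by
      rw [Set.nonempty_iff_ne_empty]
      intro h0
      have : {v : vertices P | v.1 ∈ A} = ∅ := by
        rw [Set.eq_empty_iff_forall_notMem]
        exact fun v hv => Set.eq_empty_iff_forall_notMem.1 h0 v.1 ⟨hv, v.2⟩
      rw [this, Set.image_empty, Submodule.span_empty, finrank_bot] at hr
      omega
    have hexp : IsExposed ℝ P A := fun _ => ⟨l, by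
      obtain ⟨x₀, hx₀, -⟩ := hAne
      ext x
      refine ⟨fun hx => ⟨hx.1, fun y hy => (hle y hy).trans hx.2.ge⟩, fun hx => ⟨hx.1, ?_⟩⟩
      exact le_antisymm (hle x hx.1) (hx₀.2 ▸ hx.2 x₀ hx₀.1)⟩
    refine ⟨⟨A, hexp, hAne.mono Set.inter_subset_left, ?_⟩, fun v => ?_⟩
    · rw [hrank A hAne, hvs A hexp] at hr
      change dim A + 1 = 3 at hr
      rw [hr, hdim]
    · exact (Set.ext_iff.1 hZ v).symm
  case ext =>
    intro F G hFG
    apply Subtype.ext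
    rw [← hP.convexHull_face F.2.1, ← hP.convexHull_face G.2.1]
    congr 1
    ext v
    exact ⟨fun h => ⟨(hFG ⟨v, h.2⟩).1 h.1, h.2⟩, fun h => ⟨(hFG ⟨v, h.2⟩).2 h.1, h.2⟩⟩
  case exposed =>
    intro v
    obtain ⟨l, hl⟩ := hP.exists_exposing v.2
    obtain ⟨g, hg⟩ := hfun l (l v)
    refine ⟨g, ?_, fun w hw => ?_⟩
    · rw [hg v (hvP v.2)]
      exact sub_self _
    · rw [hg w (hvP w.2)]
      exact sub_pos.2 (hl w w.2 fun h => hw (Subtype.ext h))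

end

/-! ### Quadratic forms of positive semidefinite matrices -/

theorem dot_self_nonneg (u : Fin 4 → ℝ) : 0 ≤ u ⬝ᵥ u :=
  Finset.sum_nonneg fun _ _ => mul_self_nonneg _

theorem exists_form_le (Z : Matrix (Fin 4) (Fin 4) ℝ) :
    ∃ K : ℝ, 0 ≤ K ∧ ∀ u : Fin 4 → ℝ, u ⬝ᵥ Z *ᵥ u ≤ K * (u ⬝ᵥ u) := by
  refine ⟨∑ i, ∑ j, |Z i j|, by positivity, fun u => ?_⟩
  have hu : ∀ i, u i ^ 2 ≤ u ⬝ᵥ u := fun i => by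
    rw [sq, dotProduct]
    exact Finset.single_le_sum (f := fun i => u i * u i) (fun j _ => mul_self_nonneg _)
      (Finset.mem_univ i)
  have h1 : u ⬝ᵥ Z *ᵥ u = ∑ i, ∑ j, u i * (Z i j * u j) := by
    simp [dotProduct, mulVec, Finset.mul_sum]
  rw [h1, Finset.sum_mul]
  refine Finset.sum_le_sum fun i _ => ?_
  rw [Finset.sum_mul]
  refine Finset.sum_le_sum fun j _ => ?_
  have h2 : u i * (Z i j * u j) ≤ |Z i j| * |u i * u j| := by
    rw [← abs_mul]
    refine (le_abs_self _).trans_eq (congrArg _ (by ring))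
  refine h2.trans (mul_le_mul_of_nonneg_left ?_ (abs_nonneg _))
  have h3 := hu i
  have h4 := hu j
  rw [abs_le]
  constructor <;> nlinarith [sq_nonneg (u i + u j), sq_nonneg (u i - u j)]

theorem form_symm {X : Matrix (Fin 4) (Fin 4) ℝ} (hX : X.IsHermitian) (u w : Fin 4 → ℝ) :
    u ⬝ᵥ X *ᵥ w = w ⬝ᵥ X *ᵥ u := by
  have hT : Xᵀ = X := by
    rw [← Matrix.conjTranspose_eq_transpose_of_trivial]
    exact hX
  rw [dotProduct_mulVec, ← mulVec_transpose, hT, dotProduct_comm]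

theorem form_nonneg {X : Matrix (Fin 4) (Fin 4) ℝ} (hX : X.PosSemidef) (u : Fin 4 → ℝ) :
    0 ≤ u ⬝ᵥ X *ᵥ u := by
  simpa using hX.dotProduct_mulVec_nonneg u

theorem posSemidef_of_form_nonneg {X : Matrix (Fin 4) (Fin 4) ℝ} (hX : X.IsHermitian)
    (h : ∀ u : Fin 4 → ℝ, 0 ≤ u ⬝ᵥ X *ᵥ u) : X.PosSemidef :=
  .of_dotProduct_mulVec_nonneg hX fun u => by simpa using h u

theorem form_eq_zero_iff {X : Matrix (Fin 4) (Fin 4) ℝ} (hX : X.PosSemidef) (u : Fin 4 → ℝ) :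
    u ⬝ᵥ X *ᵥ u = 0 ↔ X *ᵥ u = 0 := by
  simpa using hX.dotProduct_mulVec_zero_iff u

/-- Comparison of positive semidefinite matrices with nested kernels. -/
theorem exists_form_le_form {X Y : Matrix (Fin 4) (Fin 4) ℝ} (hX : X.PosSemidef)
    (hY : Y.PosSemidef) (hXY : ∀ z, X *ᵥ z = 0 → Y *ᵥ z = 0) :
    ∃ μ : ℝ, 0 < μ ∧ ∀ z, z ⬝ᵥ Y *ᵥ z ≤ μ * (z ⬝ᵥ X *ᵥ z) := by
  obtain ⟨h, hh⟩ := X.mulVecLin.rangeRestrict.exists_rightInverse_of_surjective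
    (LinearMap.range_rangeRestrict _)
  obtain ⟨h', hh'⟩ := LinearMap.exists_extend h
  have key : ∀ z, X *ᵥ h' (X *ᵥ z) = X *ᵥ z := fun z => by
    have h1 := LinearMap.congr_fun hh' (X.mulVecLin.rangeRestrict z)
    have h2 := LinearMap.congr_fun hh (X.mulVecLin.rangeRestrict z)
    have h3 : h' (X *ᵥ z) = h (X.mulVecLin.rangeRestrict z) := h1
    rw [h3]
    exact congrArg Subtype.val h2
  obtain ⟨K₁, hK₁, h₁⟩ := exists_form_le X
  -- This follows from nonnegativity of the form of `X` at `z - (K₁ + 1)⁻¹ • X *ᵥ z`. As `Y *ᵥ z`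
  -- depends only on `X *ᵥ z`, the form of `Y` is bounded by a multiple of `|X z|²`, hence by the
  -- form of `X`.
  have hw : ∀ z, (X *ᵥ z) ⬝ᵥ (X *ᵥ z) ≤ (K₁ + 1) * (z ⬝ᵥ X *ᵥ z) := fun z => by
    have h2 := form_nonneg hX (z - (K₁ + 1)⁻¹ • X *ᵥ z)
    have h3 := h₁ (X *ᵥ z)
    have h4 : 0 ≤ (X *ᵥ z) ⬝ᵥ (X *ᵥ z) := dot_self_nonneg _
    simp only [mulVec_sub, mulVec_smul, sub_dotProduct, dotProduct_sub, smul_dotProduct,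
      dotProduct_smul, smul_eq_mul] at h2
    rw [form_symm hX.1 z (X *ᵥ z)] at h2
    have hs : 0 < K₁ + 1 := by linarith
    field_simp at h2
    nlinarith
  obtain ⟨K₂, hK₂, h₂⟩ := exists_form_le ((LinearMap.toMatrix' h')ᵀ * Y * LinearMap.toMatrix' h')
  refine ⟨K₂ * (K₁ + 1) + 1, by positivity, fun z => ?_⟩
  have hz : Y *ᵥ z = Y *ᵥ h' (X *ᵥ z) := by
    rw [← sub_eq_zero, ← mulVec_sub]
    apply hXY
    rw [mulVec_sub, key, sub_self]
  have hz' : z ⬝ᵥ Y *ᵥ z = h' (X *ᵥ z) ⬝ᵥ Y *ᵥ h' (X *ᵥ z) := by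
    rw [hz, form_symm hY.1, hz]
  have h3 := h₂ (X *ᵥ z)
  rw [← mulVec_mulVec, ← mulVec_mulVec, LinearMap.toMatrix'_mulVec, dotProduct_mulVec,
    vecMul_transpose, LinearMap.toMatrix'_mulVec, ← hz'] at h3
  have h4 := mul_le_mul_of_nonneg_left (hw z) hK₂
  have h5 := form_nonneg hX z
  linarith

/-- A positive semidefinite matrix with one-dimensional kernel stays positive semidefinite when it
is moved slightly in a direction that is positive on the kernel. -/
theorem exists_posSemidef_add {X Z : Matrix (Fin 4) (Fin 4) ℝ} {y : Fin 4 → ℝ}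
    (hX : X.PosSemidef) (hZ : Z.IsHermitian) (hy : ∀ z, X *ᵥ z = 0 → ∃ c : ℝ, z = c • y)
    (hXy : X *ᵥ y = 0) (hZy : 0 < y ⬝ᵥ Z *ᵥ y) : ∃ t : ℝ, 0 < t ∧ (X + t • Z).PosSemidef := by
  have hy0 : 0 < y ⬝ᵥ y := by
    refine lt_of_le_of_ne (dot_self_nonneg _) fun h => ?_
    rw [dotProduct_self_eq_zero.1 h.symm] at hZy
    simp at hZy
  -- Adding `y yᵀ` removes the kernel; comparison with the identity then bounds `X` below by `μ⁻¹`
  -- on the complement of `y`.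
  have hN : (X + vecMulVec y y).PosSemidef := by
    refine hX.add ?_
    simpa using posSemidef_vecMulVec_self_star y
  have hNval : ∀ u, (X + vecMulVec y y) *ᵥ u = X *ᵥ u + (y ⬝ᵥ u) • y := fun u => by
    rw [add_mulVec, vecMulVec_mulVec]
    simp
  obtain ⟨μ, hμ, hμ'⟩ := exists_form_le_form (Y := 1) hN PosSemidef.one (by
    intro z hz
    have h1 := (form_eq_zero_iff hN z).2 hz
    rw [hNval, dotProduct_add, dotProduct_smul, smul_eq_mul, dotProduct_comm z y] at h1
    have h2 := form_nonneg hX z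
    have h3 : y ⬝ᵥ z = 0 := by nlinarith [mul_self_nonneg (y ⬝ᵥ z)]
    have h4 : z ⬝ᵥ X *ᵥ z = 0 := by
      rw [h3] at h1
      linarith
    obtain ⟨c, rfl⟩ := hy z ((form_eq_zero_iff hX z).1 h4)
    rw [dotProduct_smul, smul_eq_mul, mul_eq_zero, or_iff_left hy0.ne'] at h3
    simp [h3])
  obtain ⟨K, hK, hK'⟩ := exists_form_le (-Z)
  set ζ := y ⬝ᵥ Z *ᵥ y with hζ
  obtain ⟨K₂, hK₂, hK₂'⟩ := exists_form_le (vecMulVec (Z *ᵥ y) (Z *ᵥ y))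
  have hXu : ∀ u, y ⬝ᵥ u = 0 → u ⬝ᵥ u ≤ μ * (u ⬝ᵥ X *ᵥ u) := fun u hu => by
    have := hμ' u
    rwa [one_mulVec, hNval, hu, zero_smul, add_zero] at this
  -- For `z = u + α • y` with `u` orthogonal to `y`, completing the square in `α` bounds the form of
  -- `Z` below by `-(K + K₂ / ζ) |u|²`, while that of `X` is at least `|u|² / μ`. The summand 1
  -- keeps the constant positive.
  set t := (μ * (K + K₂ / ζ + 1))⁻¹ with ht
  have ht0 : 0 < t := by positivity
  refine ⟨t, ht0, posSemidef_of_form_nonneg (hX.1.add (hZ.smul (IsSelfAdjoint.all t))) fun z => ?_⟩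
  set α := (y ⬝ᵥ z) / (y ⬝ᵥ y) with hα
  set u := z - α • y with hu
  have hyu : y ⬝ᵥ u = 0 := by
    rw [hu, dotProduct_sub, dotProduct_smul, smul_eq_mul, hα, div_mul_cancel₀ _ hy0.ne', sub_self]
  have hz : z = u + α • y := by rw [hu, sub_add_cancel]
  have hXz : z ⬝ᵥ X *ᵥ z = u ⬝ᵥ X *ᵥ u := by
    rw [hz, mulVec_add, mulVec_smul, hXy, smul_zero, add_zero, add_dotProduct, smul_dotProduct,
      form_symm hX.1 y u, hXy, dotProduct_zero, smul_zero, add_zero]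
  have hZz : z ⬝ᵥ Z *ᵥ z = u ⬝ᵥ Z *ᵥ u + 2 * α * (u ⬝ᵥ Z *ᵥ y) + α ^ 2 * ζ := by
    rw [hz]
    simp only [mulVec_add, mulVec_smul, add_dotProduct, dotProduct_add, smul_dotProduct,
      dotProduct_smul, smul_eq_mul]
    rw [form_symm hZ y u]
    ring
  have h1 : (u ⬝ᵥ Z *ᵥ y) ^ 2 ≤ K₂ * (u ⬝ᵥ u) := by
    have := hK₂' u
    rw [vecMulVec_mulVec] at this
    simp only [op_smul_eq_smul, dotProduct_smul, smul_eq_mul] at this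
    rwa [dotProduct_comm (Z *ᵥ y) u, ← sq] at this
  have h2 : -(K * (u ⬝ᵥ u)) ≤ u ⬝ᵥ Z *ᵥ u := by
    have := hK' u
    rw [neg_mulVec, dotProduct_neg] at this
    linarith
  have h3 : -(K₂ / ζ * (u ⬝ᵥ u)) ≤ 2 * α * (u ⬝ᵥ Z *ᵥ y) + α ^ 2 * ζ := by
    have h4 : 0 ≤ (α * ζ + u ⬝ᵥ Z *ᵥ y) ^ 2 := sq_nonneg _
    rw [div_mul_eq_mul_div, neg_le_iff_add_nonneg, ← sub_nonneg]
    have : 2 * α * (u ⬝ᵥ Z *ᵥ y) + α ^ 2 * ζ + K₂ * (u ⬝ᵥ u) / ζ - 0 =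
        ((α * ζ + u ⬝ᵥ Z *ᵥ y) ^ 2 + (K₂ * (u ⬝ᵥ u) - (u ⬝ᵥ Z *ᵥ y) ^ 2)) / ζ := by
      field_simp
      ring
    rw [this]
    have := sub_nonneg.2 h1
    positivity
  have h5 := hXu u hyu
  have h6 : -((K + K₂ / ζ + 1) * (u ⬝ᵥ u)) ≤ z ⬝ᵥ Z *ᵥ z := by
    have : 0 ≤ u ⬝ᵥ u := dot_self_nonneg _
    rw [hZz]
    linarith
  rw [add_mulVec, smul_mulVec, dotProduct_add, dotProduct_smul, hXz, smul_eq_mul]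
  have h7 := mul_le_mul_of_nonneg_left h6 ht0.le
  have h8 : t * ((K + K₂ / ζ + 1) * (u ⬝ᵥ u)) = (u ⬝ᵥ u) / μ := by
    rw [ht]
    have : 0 < K + K₂ / ζ + 1 := by positivity
    generalize K + K₂ / ζ + 1 = κ at this
    field_simp
  have h9 : (u ⬝ᵥ u) / μ ≤ u ⬝ᵥ X *ᵥ u := by
    rw [div_le_iff₀ hμ]
    linarith
  linarith

/-- A positive semidefinite matrix with a kernel of codimension one is a rank-one square. -/
theorem exists_form_eq_sq {X : Matrix (Fin 4) (Fin 4) ℝ} (hX : X.PosSemidef)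
    (hk : Module.finrank ℝ (LinearMap.ker X.mulVecLin) = 3) :
    ∃ x : Fin 4 → ℝ, ∀ y, y ⬝ᵥ X *ᵥ y = (x ⬝ᵥ y) ^ 2 := by
  obtain ⟨z, hz⟩ : ∃ z, X *ᵥ z ≠ 0 := by
    by_contra! hall
    have : LinearMap.ker X.mulVecLin = ⊤ := by
      rw [eq_top_iff]
      exact fun z _ => hall z
    rw [this, finrank_top, Module.finrank_fin_fun] at hk
    omega
  set s := z ⬝ᵥ X *ᵥ z with hs
  have hs0 : 0 < s := lt_of_le_of_ne (form_nonneg hX z) fun h => hz ((form_eq_zero_iff hX z).1 h.symm)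
  have htop : LinearMap.ker X.mulVecLin ⊔ Submodule.span ℝ {z} = ⊤ := by
    have hlt : LinearMap.ker X.mulVecLin < LinearMap.ker X.mulVecLin ⊔ Submodule.span ℝ {z} := by
      refine lt_of_le_of_ne le_sup_left fun h => hz ?_
      have : z ∈ LinearMap.ker X.mulVecLin :=
        h ▸ Submodule.mem_sup_right (Submodule.mem_span_singleton_self z)
      exact this
    have h1 := Submodule.finrank_lt_finrank_of_lt hlt
    have h2 := Submodule.finrank_le (LinearMap.ker X.mulVecLin ⊔ Submodule.span ℝ {z})
    rw [Module.finrank_fin_fun] at h2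
    apply Submodule.eq_top_of_finrank_eq
    rw [Module.finrank_fin_fun]
    omega
  -- Since `ℝ⁴` is the kernel plus the line of `z`, the form is determined by its value `s` at `z`.
  refine ⟨(√s)⁻¹ • X *ᵥ z, fun y => ?_⟩
  obtain ⟨n, hn, m, hm, rfl⟩ := Submodule.mem_sup.1 (htop ▸ Submodule.mem_top : y ∈ _)
  obtain ⟨c, rfl⟩ := Submodule.mem_span_singleton.1 hm
  have hn' : X *ᵥ n = 0 := hn
  have h1 : (X *ᵥ z) ⬝ᵥ n = 0 := by
    rw [dotProduct_comm, form_symm hX.1, hn', dotProduct_zero]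
  have h2 : n ⬝ᵥ X *ᵥ z = 0 := by rw [dotProduct_comm, h1]
  have h3 : (X *ᵥ z) ⬝ᵥ z = s := dotProduct_comm _ _
  simp only [mulVec_add, mulVec_smul, add_dotProduct, dotProduct_add, smul_dotProduct,
    dotProduct_smul, smul_eq_mul, hn', h1, h2, h3, dotProduct_zero, ← hs]
  have h4 : √s ≠ 0 := (Real.sqrt_pos.2 hs0).ne'
  field_simp
  rw [Real.sq_sqrt hs0.le]
  ring

/-! ### From a psd lift to a square root of the slack matrix -/

section

variable {L : AffineSubspace ℝ (Matrix (Fin 4) (Fin 4) ℝ)}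

/-- A slice of the cone of positive semidefinite matrices by an affine subspace. -/
def psdSlice (L : AffineSubspace ℝ (Matrix (Fin 4) (Fin 4) ℝ)) :
    Set (Matrix (Fin 4) (Fin 4) ℝ) := {X | X.PosSemidef ∧ X ∈ L}

/-- If the kernel of `X` lay in that of `Y`, then `Y ≤ μ X`, and the segment from `Y` to `X` could
be prolonged inside the slice beyond `X`, where `l` would exceed `m`. -/
theorem exists_ker_not_le {l : Matrix (Fin 4) (Fin 4) ℝ →ₗ[ℝ] ℝ} {m : ℝ}
    (hl : ∀ X ∈ psdSlice L, l X ≤ m) {X Y : Matrix (Fin 4) (Fin 4) ℝ} (hX : X ∈ psdSlice L)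
    (hY : Y ∈ psdSlice L) (hXm : l X = m) (hYm : l Y < m) : ∃ z, X *ᵥ z = 0 ∧ Y *ᵥ z ≠ 0 := by
  by_contra! hall
  obtain ⟨μ, hμ, h⟩ := exists_form_le_form hX.1 hY.1 hall
  have hmem : X + μ⁻¹ • (X - Y) ∈ psdSlice L := by
    constructor
    · refine posSemidef_of_form_nonneg
        (hX.1.1.add ((hX.1.1.sub hY.1.1).smul (IsSelfAdjoint.all _))) fun z => ?_
      have h1 := h z
      have h2 := form_nonneg hX.1 z
      rw [add_mulVec, smul_mulVec, sub_mulVec, dotProduct_add, dotProduct_smul, dotProduct_sub,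
        smul_eq_mul]
      have h3 : 0 ≤ μ⁻¹ * (z ⬝ᵥ X *ᵥ z) := by positivity
      have h4 : μ⁻¹ * (z ⬝ᵥ Y *ᵥ z) ≤ z ⬝ᵥ X *ᵥ z := by
        rw [inv_mul_le_iff₀ hμ]
        exact h1
      linarith
    · have h1 := L.vsub_mem_direction hX.2 hY.2
      have h2 := AffineSubspace.vadd_mem_of_mem_direction (L.direction.smul_mem μ⁻¹ h1) hX.2
      rwa [vadd_eq_add, add_comm, vsub_eq_sub] at h2
  have h1 := hl _ hmem
  rw [map_add, map_smul, map_sub, hXm, smul_eq_mul] at h1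
  have : 0 < μ⁻¹ * (m - l Y) := mul_pos (inv_pos.2 hμ) (sub_pos.2 hYm)
  linarith

theorem average_mem {X Y : Matrix (Fin 4) (Fin 4) ℝ} (hX : X ∈ psdSlice L)
    (hY : Y ∈ psdSlice L) : (1 / 2 : ℝ) • X + (1 / 2 : ℝ) • Y ∈ psdSlice L := by
  refine ⟨(hX.1.smul (by norm_num)).add (hY.1.smul (by norm_num)), ?_⟩
  have h1 := L.vsub_mem_direction hY.2 hX.2
  have h2 := AffineSubspace.vadd_mem_of_mem_direction (L.direction.smul_mem (1 / 2 : ℝ) h1) hX.2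
  rw [vadd_eq_add, vsub_eq_sub] at h2
  convert h2 using 1
  module

/-- Adding a point outside a face lowers the dimension of the kernel. -/
theorem finrank_ker_average_lt {l : Matrix (Fin 4) (Fin 4) ℝ →ₗ[ℝ] ℝ} {m : ℝ}
    (hl : ∀ X ∈ psdSlice L, l X ≤ m) {X Y : Matrix (Fin 4) (Fin 4) ℝ} (hX : X ∈ psdSlice L)
    (hY : Y ∈ psdSlice L) (hXm : l X = m) (hYm : l Y < m) :
    Module.finrank ℝ (LinearMap.ker ((1 / 2 : ℝ) • X + (1 / 2 : ℝ) • Y).mulVecLin) <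
      Module.finrank ℝ (LinearMap.ker X.mulVecLin) := by
  have hsub : ∀ z, ((1 / 2 : ℝ) • X + (1 / 2 : ℝ) • Y) *ᵥ z = 0 → X *ᵥ z = 0 ∧ Y *ᵥ z = 0 := by
    intro z hz
    rw [← form_eq_zero_iff (average_mem hX hY).1, add_mulVec, smul_mulVec, smul_mulVec,
      dotProduct_add, dotProduct_smul, dotProduct_smul, smul_eq_mul, smul_eq_mul] at hz
    have h1 := form_nonneg hX.1 z
    have h2 := form_nonneg hY.1 z
    rw [← form_eq_zero_iff hX.1, ← form_eq_zero_iff hY.1]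
    constructor <;> linarith
  apply Submodule.finrank_lt_finrank_of_lt
  obtain ⟨z, hzX, hzY⟩ := exists_ker_not_le hl hX hY hXm hYm
  refine lt_of_le_of_ne (fun z hz => (hsub z hz).1) fun h => hzY (hsub z ?_).2
  have : z ∈ LinearMap.ker X.mulVecLin := hzX
  rw [← h] at this
  exact this

/-- On a slice that contains a positive definite matrix, a functional that vanishes at a matrix
with kernel spanned by `y` is proportional to the quadratic form at `y`. -/
theorem functional_eq_form {l : Matrix (Fin 4) (Fin 4) ℝ →ₗ[ℝ] ℝ} {m : ℝ}
    (hl : ∀ X ∈ psdSlice L, l X ≤ m) {X₀ X₁ : Matrix (Fin 4) (Fin 4) ℝ} (h₀ : X₀ ∈ psdSlice L)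
    (h₁ : X₁ ∈ psdSlice L) (hm : l X₀ = m) {y : Fin 4 → ℝ}
    (hy : ∀ z, X₀ *ᵥ z = 0 → ∃ c : ℝ, z = c • y) (hX₀y : X₀ *ᵥ y = 0)
    (hX₁y : 0 < y ⬝ᵥ X₁ *ᵥ y) {X : Matrix (Fin 4) (Fin 4) ℝ} (hX : X ∈ psdSlice L) :
    m - l X = ((m - l X₁) / (y ⬝ᵥ X₁ *ᵥ y)) * (y ⬝ᵥ X *ᵥ y) := by
  set q₁ := y ⬝ᵥ X₁ *ᵥ y with hq₁
  set q := y ⬝ᵥ X *ᵥ y with hq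
  -- A direction that is positive on `y` can be followed a little from `X₀` inside the slice, and
  -- there `l ≤ m`. A linear form in `(α, β)` that is nonnegative on an open half-plane is a
  -- multiple of the one defining it; pairs near the boundary line show this.
  have key : ∀ α β : ℝ, 0 < α * q + β * q₁ → 0 ≤ α * (m - l X) + β * (m - l X₁) := by
    intro α β hαβ
    have hZ : (α • (X - X₀) + β • (X₁ - X₀)).IsHermitian :=
      ((hX.1.1.sub h₀.1.1).smul (IsSelfAdjoint.all α)).add
        ((h₁.1.1.sub h₀.1.1).smul (IsSelfAdjoint.all β))
    obtain ⟨t, ht, hpsd⟩ := exists_posSemidef_add h₀.1 hZ hy hX₀y (by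
      simp only [add_mulVec, smul_mulVec, sub_mulVec, hX₀y, sub_zero, dotProduct_add,
        dotProduct_smul, smul_eq_mul, ← hq, ← hq₁]
      exact hαβ)
    have hmem : X₀ + t • (α • (X - X₀) + β • (X₁ - X₀)) ∈ L := by
      have h1 := L.direction.smul_mem t (L.direction.add_mem
        (L.direction.smul_mem α (L.vsub_mem_direction hX.2 h₀.2))
        (L.direction.smul_mem β (L.vsub_mem_direction h₁.2 h₀.2)))
      have h2 := AffineSubspace.vadd_mem_of_mem_direction h1 h₀.2
      rwa [vadd_eq_add, add_comm, vsub_eq_sub, vsub_eq_sub] at h2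
    have h3 := hl _ ⟨hpsd, hmem⟩
    simp only [map_add, map_smul, map_sub, hm, smul_eq_mul] at h3
    have h4 : t * (α * (l X - m) + β * (l X₁ - m)) ≤ 0 := by linarith
    have h5 := nonpos_of_mul_nonpos_right h4 ht
    linarith
  have hq₁0 : q₁ ≠ 0 := hX₁y.ne'
  have hg₁ : 0 ≤ m - l X₁ := sub_nonneg.2 (hl X₁ h₁)
  rw [div_mul_eq_mul_div, eq_div_iff hq₁0]
  have hlim : ∀ s : ℝ, (∀ ε : ℝ, 0 < ε → 0 ≤ s + ε * (m - l X₁)) → 0 ≤ s := by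
    intro s hs
    by_contra! hneg
    have hε : 0 < -s / (2 * (m - l X₁ + 1)) := by
      apply div_pos <;> linarith
    have h1 := hs _ hε
    have h2 : -s / (2 * (m - l X₁ + 1)) * (m - l X₁) ≤ -s / 2 := by
      rw [div_mul_eq_mul_div, div_le_div_iff₀ (by linarith) (by norm_num)]
      nlinarith
    linarith
  apply le_antisymm
  · rw [← sub_nonneg]
    refine hlim _ fun ε hε => ?_
    have := key (-q₁) (q + ε) (by nlinarith [mul_pos hε hX₁y])
    linarith
  · rw [← sub_nonneg]
    refine hlim _ fun ε hε => ?_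
    have := key q₁ (-q + ε) (by nlinarith [mul_pos hε hX₁y])
    linarith

variable {n : ℕ} {P : Set (EuclideanSpace ℝ (Fin n))}

/-- A psd lift of size four of a three-dimensional polytope gives a square root of rank at most
four of its slack matrix. -/
theorem hasSqrt_of_hasPsdLift (hlift : HasPsdLift 4 P) (R : PolyRep (vertices P) (facets P))
    (hR : ∀ F : facets P, ∃ (l : EuclideanSpace ℝ (Fin n) →ₗ[ℝ] ℝ) (m : ℝ),
        (∀ x ∈ P, l x ≤ m) ∧ ∀ v, R.p v ⬝ᵥ R.f F = m - l v) : R.HasSqrt := by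
  obtain ⟨L, π, hP⟩ := hlift
  change P = π '' psdSlice L at hP
  choose l m hlm hval using hR
  have hl : ∀ F, ∀ X ∈ psdSlice L, (l F ∘ₗ π) X ≤ m F := fun F X hX => by
    apply hlm F
    rw [hP]
    exact ⟨X, hX, rfl⟩
  have hX : ∀ v : vertices P, ∃ X ∈ psdSlice L, π X = v := fun v => by
    have : v.1 ∈ π '' psdSlice L := hP ▸ extremePoints_subset v.2
    exact this
  choose X hXL hXv using hX
  have hin : ∀ {v F}, R.I v F → (l F ∘ₗ π) (X v) = m F := fun {v F} h => by
    have := hval F v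
    rw [R.zero h] at this
    rw [LinearMap.comp_apply, hXv]
    linarith
  have hout : ∀ {v F}, ¬ R.I v F → (l F ∘ₗ π) (X v) < m F := fun {v F} h => by
    have := R.pos h
    rw [hval F v] at this
    rw [LinearMap.comp_apply, hXv]
    linarith
  -- If zero were in the slice over `v`, the slice would contain `2 X a`, and the vertex `a` would
  -- be the midpoint of `v = 0` and `2 a`.
  have hX0 : ∀ v, X v ≠ 0 := by
    intro v hv
    obtain ⟨G, hG⟩ := R.exists_facet v
    obtain ⟨a, b, A, B, hf⟩ := R.flag v G hG
    have hv0 : v.1 = 0 := by rw [← hXv v, hv, map_zero]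
    have h0L : (0 : Matrix (Fin 4) (Fin 4) ℝ) ∈ L := hv ▸ (hXL v).2
    have h2 : (2 : ℝ) • X a ∈ psdSlice L := by
      refine ⟨(hXL a).1.smul (by norm_num), ?_⟩
      have h1 := L.vsub_mem_direction (hXL a).2 h0L
      have h3 := AffineSubspace.vadd_mem_of_mem_direction (L.direction.smul_mem 2 h1) h0L
      rwa [vadd_eq_add, add_zero, vsub_eq_sub, sub_zero] at h3
    have h2P : (2 : ℝ) • a.1 ∈ P := hP.ge ⟨_, h2, by rw [map_smul, hXv]⟩
    have hvP : v.1 ∈ P := extremePoints_subset v.2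
    have hmem : a.1 ∈ openSegment ℝ v.1 ((2 : ℝ) • a.1) :=
      ⟨1 / 2, 1 / 2, by norm_num, by norm_num, by norm_num, by rw [hv0, smul_smul]; norm_num⟩
    exact hf.av (Subtype.ext (a.2.2 hvP h2P hmem).symm)
  -- Averaging in `a`, `b` and a vertex off `G` leaves a face each time and lowers the kernel
  -- dimension. It starts at most at 3 and drops three times, so it is 3, 2, 1, 0.
  have hchain : ∀ v G, R.I v G → Module.finrank ℝ (LinearMap.ker (X v).mulVecLin) = 3 ∧
      ∃ X₀ ∈ psdSlice L, ∃ X₁ ∈ psdSlice L, (l G ∘ₗ π) X₀ = m G ∧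
        Module.finrank ℝ (LinearMap.ker X₀.mulVecLin) = 1 ∧
        Module.finrank ℝ (LinearMap.ker X₁.mulVecLin) = 0 := by
    intro v G hG
    obtain ⟨a, b, A, B, hf⟩ := R.flag v G hG
    obtain ⟨w, hw⟩ := R.dual.exists_not_mem G
    have hw : ¬ R.I w G := hw
    have avg : ∀ {l : Matrix (Fin 4) (Fin 4) ℝ →ₗ[ℝ] ℝ} {m : ℝ} {X Y}, l X = m → l Y = m →
        l ((1 / 2 : ℝ) • X + (1 / 2 : ℝ) • Y) = m := by
      intro l m X Y h1 h2
      rw [map_add, map_smul, map_smul, h1, h2, smul_eq_mul]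
      ring
    have m1 := average_mem (hXL v) (hXL a)
    have m2 := average_mem m1 (hXL b)
    have m3 := average_mem m2 (hXL w)
    have g1 := avg (hin hf.vG) (hin hf.aG)
    have g2 := avg g1 (hin hf.bG)
    have d1 := finrank_ker_average_lt (hl B) (hXL v) (hXL a) (hin hf.vB) (hout hf.aB)
    have d2 := finrank_ker_average_lt (hl A) m1 (hXL b) (avg (hin hf.vA) (hin hf.aA)) (hout hf.bA)
    have d3 := finrank_ker_average_lt (hl G) m2 (hXL w) g2 (hout hw)
    have d0 : Module.finrank ℝ (LinearMap.ker (X v).mulVecLin) < 4 := by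
      have : LinearMap.ker (X v).mulVecLin ≠ ⊤ := by
        intro h
        rw [LinearMap.ker_eq_top] at h
        refine hX0 v (Matrix.toLin'.injective ?_)
        rw [map_zero]
        exact h
      have := Submodule.finrank_lt this
      rwa [Module.finrank_fin_fun] at this
    exact ⟨by omega, _, m2, _, m3, g2, by omega, by omega⟩
  have hx : ∀ v, ∃ x : Fin 4 → ℝ, ∀ y, y ⬝ᵥ X v *ᵥ y = (x ⬝ᵥ y) ^ 2 := fun v => by
    obtain ⟨G, hG⟩ := R.exists_facet v
    exact exists_form_eq_sq (hXL v).1 (hchain v G hG).1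
  have hy : ∀ G, ∃ y : Fin 4 → ℝ, ∀ Y ∈ psdSlice L, m G - (l G ∘ₗ π) Y = y ⬝ᵥ Y *ᵥ y := fun G => by
    obtain ⟨v, hv⟩ := R.exists_vertex G
    obtain ⟨-, X₀, h₀, X₁, h₁, hm, hk₀, hk₁⟩ := hchain v G hv
    obtain ⟨⟨y, hy⟩, hy0, hspan⟩ := finrank_eq_one_iff'.1 hk₀
    have hker₁ : X₁ *ᵥ y ≠ 0 := fun h => by
      have h1 : y ∈ LinearMap.ker X₁.mulVecLin := h
      rw [Submodule.finrank_eq_zero.1 hk₁, Submodule.mem_bot] at h1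
      exact hy0 (Subtype.ext h1)
    have hpos : 0 < y ⬝ᵥ X₁ *ᵥ y :=
      lt_of_le_of_ne (form_nonneg h₁.1 y) fun h => hker₁ ((form_eq_zero_iff h₁.1 y).1 h.symm)
    have hc : 0 ≤ (m G - (l G ∘ₗ π) X₁) / (y ⬝ᵥ X₁ *ᵥ y) :=
      div_nonneg (sub_nonneg.2 (hl G X₁ h₁)) hpos.le
    refine ⟨√((m G - (l G ∘ₗ π) X₁) / (y ⬝ᵥ X₁ *ᵥ y)) • y, fun Y hY => ?_⟩
    rw [functional_eq_form (hl G) h₀ h₁ hm (fun z hz => ?_) hy hpos hY, mulVec_smul,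
      dotProduct_smul, smul_dotProduct, smul_smul, smul_eq_mul, Real.mul_self_sqrt hc]
    obtain ⟨c, hc⟩ := hspan ⟨z, hz⟩
    exact ⟨c, (congrArg Subtype.val hc).symm⟩
  choose x hx using hx
  choose y hy using hy
  refine ⟨x, y, fun v G => ?_⟩
  rw [← hx, ← hy G _ (hXL v), hval, LinearMap.comp_apply, hXv]

end

/-! ### Explicit polytopes with a given incidence table -/

/-- The points `q i` and the inequalities `⟪x, N j⟫ ≤ 1` realise the incidence table `T`. -/
structure Realizes {m k : ℕ} (T : Fin m → Fin k → Bool) (q : Fin m → EuclideanSpace ℝ (Fin 3))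
    (N : Fin k → EuclideanSpace ℝ (Fin 3)) : Prop where
  le_one : ∀ i j, inner ℝ (q i) (N j) ≤ 1
  eq_one_iff : ∀ i j, inner ℝ (q i) (N j) = 1 ↔ T i j = true

namespace Realizes
variable {m k : ℕ} {T : Fin m → Fin k → Bool} {q : Fin m → EuclideanSpace ℝ (Fin 3)}
  {N : Fin k → EuclideanSpace ℝ (Fin 3)}

theorem transpose (h : Realizes T q N) : Realizes (fun j i => T i j) N q where
  le_one j i := by rw [real_inner_comm]; exact h.le_one i j
  eq_one_iff j i := by rw [real_inner_comm]; exact h.eq_one_iff i j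

theorem inner_le_one (h : Realizes T q N) {x : EuclideanSpace ℝ (Fin 3)}
    (hx : x ∈ convexHull ℝ (Set.range q)) (j : Fin k) : inner ℝ x (N j) ≤ 1 := by
  have : convexHull ℝ (Set.range q) ⊆ {x | innerₗ _ (N j) x ≤ 1} := by
    refine convexHull_min ?_ (convex_halfSpace_le (innerₗ _ (N j)).isLinear 1)
    rintro _ ⟨i, rfl⟩
    change inner ℝ (N j) (q i) ≤ 1
    rw [real_inner_comm]
    exact h.le_one i j
  rw [real_inner_comm]
  exact this hx

/-- The sum of the normals of the listed facets through `q i` is larger at `q i` than at every other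
listed point, because no other row of the table contains row `i`. -/
theorem mem_vertices (h : Realizes T q N) (hT : PolyRep.IsClosedTable T) (i : Fin m) :
    q i ∈ vertices (convexHull ℝ (Set.range q)) := by
  have hQ : IsPolytope (convexHull ℝ (Set.range q)) := ⟨_, Set.finite_range q, rfl⟩
  by_contra hi
  let f : EuclideanSpace ℝ (Fin 3) →ₗ[ℝ] ℝ := ∑ j with T i j = true, innerₗ _ (N j)
  have hf : ∀ x, f x = ∑ j with T i j = true, inner ℝ (N j) x := fun x => by
    simp [f, LinearMap.sum_apply]
  have hsub : convexHull ℝ (vertices (convexHull ℝ (Set.range q))) ⊆ {x | f x < f (q i)} := by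
    refine convexHull_min ?_ (convex_halfSpace_lt f.isLinear _)
    intro x hx
    obtain ⟨i', rfl⟩ := extremePoints_convexHull_subset hx
    have hne : i' ≠ i := fun h => hi (h ▸ hx)
    change f _ < f _
    rw [hf, hf]
    have hle : ∀ j, T i j = true → inner ℝ (N j) (q i) = 1 := fun j hj => by
      rw [real_inner_comm]
      exact (h.eq_one_iff i j).2 hj
    obtain ⟨j, hj, hj'⟩ : ∃ j, T i j = true ∧ ¬ T i' j = true := by
      by_contra! hall
      exact hne (hT.row_anti i i' hall).symm
    refine Finset.sum_lt_sum (fun j hj => ?_) ⟨j, by simpa using hj, ?_⟩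
    · rw [hle j (by simpa using hj), real_inner_comm]
      exact h.le_one i' j
    · rw [hle j hj, real_inner_comm]
      exact lt_of_le_of_ne (h.le_one i' j) fun h1 => hj' ((h.eq_one_iff i' j).1 h1)
  rw [hQ.convexHull_vertices] at hsub
  exact lt_irrefl (f (q i)) (hsub (subset_convexHull ℝ _ ⟨i, rfl⟩))

/-- The inequalities only give some facets, recognised by triangular systems that compute
dimensions. That there are no others follows from the closedness of the table. -/
theorem hasTable (h : Realizes T q N) (hT : PolyRep.IsClosedTable T) :
    HasTable (fun (v : vertices (convexHull ℝ (Set.range q)))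
      (F : facets (convexHull ℝ (Set.range q))) => v.1 ∈ F.1) T := by
  set Q := convexHull ℝ (Set.range q) with hQdef
  have hQ : IsPolytope Q := ⟨_, Set.finite_range q, rfl⟩
  have hqQ : ∀ i, q i ∈ Q := fun i => subset_convexHull ℝ _ ⟨i, rfl⟩
  let F : Fin k → Set (EuclideanSpace ℝ (Fin 3)) := fun j => {x ∈ Q | inner ℝ x (N j) = 1}
  have hF : ∀ i j, q i ∈ F j ↔ T i j = true := fun i j =>
    ⟨fun hi => (h.eq_one_iff i j).1 hi.2, fun hi => ⟨hqQ i, (h.eq_one_iff i j).2 hi⟩⟩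
  have val : ∀ {i j}, T i j = true → inner ℝ (N j) (q i) = 1 := fun {i j} hi => by
    rw [real_inner_comm]
    exact (h.eq_one_iff i j).2 hi
  have val' : ∀ {i j}, T i j = false → inner ℝ (N j) (q i) ≠ 1 := fun {i j} hi h1 => by
    rw [real_inner_comm, h.eq_one_iff, hi] at h1
    exact Bool.false_ne_true h1
  have hspace : Module.finrank ℝ (EuclideanSpace ℝ (Fin 3)) = 3 := by simp
  have hdims : ∀ j, dim (F j) = 2 ∧ dim Q = 3 := by
    intro j
    obtain ⟨a, ha⟩ := hT.exists_row j
    obtain ⟨u, hu⟩ := hT.exists_not j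
    obtain ⟨a', ⟨h1, h2⟩, b', ⟨h3, h4, h5⟩, a'', ⟨h6, h7⟩, b'', h8, h9, h10, h11⟩ :=
      hT.nbrs a j ha
    have sub : ∀ {i i'}, q i ∈ F j → q i' ∈ F j → q i - q i' ∈ vectorSpan ℝ (F j) :=
      fun h h' => vsub_mem_vectorSpan ℝ h h'
    have subQ : ∀ {i i'}, q i - q i' ∈ vectorSpan ℝ Q :=
      fun {i i'} => vsub_mem_vectorSpan ℝ (hqQ i) (hqQ i')
    have two : 2 ≤ dim (F j) := by
      refine le_finrank_of_triangular (q := ![q a' - q a, q a'' - q a])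
        (g := ![innerₗ _ (N b''), innerₗ _ (N b')]) ?_ ?_ ?_
      · simp [Fin.forall_fin_succ, inner_sub_right, val h9, val h4, sub_eq_zero, val' h11, val' h7]
      · simp [Fin.forall_fin_succ, inner_sub_right, val h5, val h4]
      · simp only [Fin.forall_fin_succ]
        exact ⟨sub ((hF _ _).2 h1) ((hF _ _).2 ha), sub ((hF _ _).2 h6) ((hF _ _).2 ha),
          fun i => i.elim0⟩
    have three : 3 ≤ dim Q := by
      refine le_finrank_of_triangular (q := ![q a' - q a, q a'' - q a, q u - q a])
        (g := ![innerₗ _ (N b''), innerₗ _ (N b'), innerₗ _ (N j)]) ?_ ?_ ?_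
      · simp [Fin.forall_fin_succ, inner_sub_right, val h9, val h4, val ha, sub_eq_zero, val' h11,
          val' h7, val' hu]
      · simp [Fin.forall_fin_succ, inner_sub_right, val h5, val h4, val h1, val ha, val h6]
      · simp only [Fin.forall_fin_succ]
        exact ⟨subQ, subQ, subQ, fun i => i.elim0⟩
    have hlt : dim (F j) < 3 := by
      refine (Submodule.finrank_lt fun htop => ?_).trans_eq hspace
      have hle : vectorSpan ℝ (F j) ≤ LinearMap.ker (innerₗ (EuclideanSpace ℝ (Fin 3)) (N j)) := by
        rw [vectorSpan_def, Submodule.span_le]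
        rintro _ ⟨x, hx, y, hy, rfl⟩
        have e1 : inner ℝ (N j) x = 1 := by rw [real_inner_comm]; exact hx.2
        have e2 : inner ℝ (N j) y = 1 := by rw [real_inner_comm]; exact hy.2
        change inner ℝ (N j) (x - y) = 0
        rw [inner_sub_right, e1, e2, sub_self]
      have h0 : inner ℝ (N j) (q a) = (0 : ℝ) := hle (htop ▸ Submodule.mem_top)
      rw [val ha] at h0
      exact one_ne_zero h0
    have hle : dim Q ≤ 3 := (Submodule.finrank_le _).trans_eq hspace
    omega
  have hfac : ∀ j, F j ∈ facets Q := by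
    intro j
    obtain ⟨a, ha⟩ := hT.exists_row j
    refine ⟨fun _ => ⟨innerSL ℝ (N j), ?_⟩, ⟨q a, (hF a j).2 ha⟩, ?_⟩
    · ext x
      change (x ∈ Q ∧ inner ℝ x (N j) = 1) ↔ x ∈ Q ∧ ∀ y ∈ Q, inner ℝ (N j) y ≤ inner ℝ (N j) x
      rw [real_inner_comm]
      refine and_congr_right fun hx => ⟨fun h1 y hy => ?_, fun hmax => ?_⟩
      · rw [h1, real_inner_comm]
        exact h.inner_le_one hy j
      · refine le_antisymm ?_ ?_
        · rw [real_inner_comm]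
          exact h.inner_le_one hx j
        · exact (val ha).symm.trans_le (hmax _ (hqQ a))
    · rw [(hdims j).1, (hdims j).2]
  obtain ⟨j₀, -⟩ := hT.exists_col ⟨0, hT.pos⟩
  obtain ⟨p, f, h', S, -⟩ := isFacetSystem hQ (hdims j₀).2
  have hfinV : Finite (vertices Q) := hQ.finite_vertices
  have hfinF : Finite (facets Q) := by
    refine Finite.of_injective (fun F : facets Q => {v : vertices Q | v.1 ∈ F.1}) ?_
    exact fun F G hFG => S.ext F G fun v => Set.ext_iff.1 hFG v
  exact S.polyRep.hasTable_of_table hT (fun i => ⟨q i, h.mem_vertices hT i⟩)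
    (fun j => ⟨F j, hfac j⟩) hF

theorem convexHull_subset_polarBody (h : Realizes T q N) :
    convexHull ℝ (Set.range N) ⊆ polarBody (convexHull ℝ (Set.range q)) := by
  intro y hy x hx
  have hsub : convexHull ℝ (Set.range N) ⊆ {y | innerₗ _ x y ≤ 1} := by
    refine convexHull_min ?_ (convex_halfSpace_le (innerₗ _ x).isLinear 1)
    rintro _ ⟨j, rfl⟩
    exact h.inner_le_one hx j
  exact hsub hy

end Realizes

theorem inner_fin_three (a b c x y z : ℝ) :
    inner ℝ (!₂[a, b, c] : EuclideanSpace ℝ (Fin 3)) !₂[x, y, z] = a * x + b * y + c * z := by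
  simp [PiLp.inner_apply, Fin.sum_univ_three]
  ring

/-- The vertices of `simplex`, in the order of `simplexTable`. -/
def simplexPts : Fin 4 → EuclideanSpace ℝ (Fin 3) :=
  ![!₂[1, 0, 0], !₂[0, 1, 0], !₂[0, 0, 1], !₂[-1, -1, -1]]

/-- The outer normals of the facets of `simplex`, in the order of `simplexTable`. -/
def simplexNormals : Fin 4 → EuclideanSpace ℝ (Fin 3) :=
  ![!₂[1, 1, 1], !₂[1, 1, -3], !₂[1, -3, 1], !₂[-3, 1, 1]]

/-- The vertices of `quadPyramid`, in the order of `pyramidTable`. -/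
def pyramidPts : Fin 5 → EuclideanSpace ℝ (Fin 3) :=
  ![!₂[0, 0, 1], !₂[1, 1, -1], !₂[-1, 1, -1], !₂[-1, -1, -1], !₂[1, -1, -1]]

/-- The outer normals of the facets of `quadPyramid`, in the order of `pyramidTable`. -/
def pyramidNormals : Fin 5 → EuclideanSpace ℝ (Fin 3) :=
  ![!₂[2, 0, 1], !₂[0, 2, 1], !₂[-2, 0, 1], !₂[0, -2, 1], !₂[0, 0, -1]]

/-- The vertices of `quadPyramid`, in the order of the transpose of `pyramidTable`. -/
def pyramidPts' : Fin 5 → EuclideanSpace ℝ (Fin 3) :=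
  ![!₂[1, 1, -1], !₂[-1, 1, -1], !₂[-1, -1, -1], !₂[1, -1, -1], !₂[0, 0, 1]]

/-- The outer normals of the facets of `quadPyramid`, in the order of the transpose of
`pyramidTable`. -/
def pyramidNormals' : Fin 5 → EuclideanSpace ℝ (Fin 3) :=
  ![!₂[0, 0, -1], !₂[0, 2, 1], !₂[-2, 0, 1], !₂[0, -2, 1], !₂[2, 0, 1]]

/-- The vertices of `bisimplex`, in the order of `bisimplexTable`. -/
def bisimplexPts : Fin 5 → EuclideanSpace ℝ (Fin 3) :=
  ![!₂[1, 0, 0], !₂[0, 0, 1], !₂[0, 1, 0], !₂[0, 0, -1], !₂[-1, -1, 0]]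

/-- The outer normals of the facets of `bisimplex`, in the order of `bisimplexTable`. -/
def bisimplexNormals : Fin 6 → EuclideanSpace ℝ (Fin 3) :=
  ![!₂[1, -2, 1], !₂[1, 1, 1], !₂[1, 1, -1], !₂[1, -2, -1], !₂[-2, 1, 1], !₂[-2, 1, -1]]

/-- The vertices of `octahedron`, in the order of `octahedronTable`. -/
def octahedronPts : Fin 6 → EuclideanSpace ℝ (Fin 3) :=
  ![!₂[0, 0, 1], !₂[1, 0, 0], !₂[0, 1, 0], !₂[-1, 0, 0], !₂[0, -1, 0], !₂[0, 0, -1]]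

/-- The outer normals of the facets of `octahedron`, in the order of `octahedronTable`. -/
def octahedronNormals : Fin 8 → EuclideanSpace ℝ (Fin 3) :=
  ![!₂[1, -1, 1], !₂[1, 1, 1], !₂[-1, 1, 1], !₂[-1, -1, 1], !₂[1, -1, -1], !₂[1, 1, -1],
    !₂[-1, 1, -1], !₂[-1, -1, -1]]

theorem realizes_simplex : Realizes simplexTable simplexPts simplexNormals := by
  constructor <;> intro i j <;> fin_cases i <;> fin_cases j <;>
    simp [simplexTable, simplexPts, simplexNormals, inner_fin_three] <;> norm_num

theorem realizes_pyramid : Realizes pyramidTable pyramidPts pyramidNormals := by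
  constructor <;> intro i j <;> fin_cases i <;> fin_cases j <;>
    simp [pyramidTable, pyramidPts, pyramidNormals, inner_fin_three] <;> norm_num

/-- The pyramid is self-dual, so the transposed table is realised by the same polytope with another
labelling and its polar is not needed. -/
theorem realizes_pyramid' :
    Realizes (fun j i => pyramidTable i j) pyramidPts' pyramidNormals' := by
  constructor <;> intro i j <;> fin_cases i <;> fin_cases j <;>
    simp [pyramidTable, pyramidPts', pyramidNormals', inner_fin_three] <;> norm_num

theorem realizes_bisimplex : Realizes bisimplexTable bisimplexPts bisimplexNormals := by
  constructor <;> intro i j <;> fin_cases i <;> fin_cases j <;>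
    simp [bisimplexTable, bisimplexPts, bisimplexNormals, inner_fin_three] <;> norm_num

theorem realizes_octahedron : Realizes octahedronTable octahedronPts octahedronNormals := by
  constructor <;> intro i j <;> fin_cases i <;> fin_cases j <;>
    simp [octahedronTable, octahedronPts, octahedronNormals, inner_fin_three] <;> norm_num

theorem isClosedTable_pyramid_transpose :
    PolyRep.IsClosedTable (fun j i => pyramidTable i j) :=
  ⟨by decide, by decide, by decide, by decide, by decide, by decide, by decide⟩

theorem isClosedTable_bisimplex_transpose :
    PolyRep.IsClosedTable (fun j i => bisimplexTable i j) :=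
  ⟨by decide, by decide, by decide, by decide, by decide, by decide, by decide⟩

set_option maxRecDepth 4000 in
theorem isClosedTable_octahedron_transpose :
    PolyRep.IsClosedTable (fun j i => octahedronTable i j) :=
  ⟨by decide, by decide, by decide, by decide, by decide, by decide, by decide⟩

theorem simplex_eq : simplex = convexHull ℝ (Set.range simplexPts) := by
  rw [simplex]
  congr 1
  ext x
  simp [simplexPts]
  tauto

theorem quadPyramid_eq : quadPyramid = convexHull ℝ (Set.range pyramidPts) := by
  rw [quadPyramid]
  congr 1
  ext x
  simp [pyramidPts]
  tauto

theorem quadPyramid_eq' : quadPyramid = convexHull ℝ (Set.range pyramidPts') := by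
  rw [quadPyramid]
  congr 1
  ext x
  simp [pyramidPts']
  tauto

theorem bisimplex_eq : bisimplex = convexHull ℝ (Set.range bisimplexPts) := by
  rw [bisimplex]
  congr 1
  ext x
  simp [bisimplexPts]
  tauto

theorem octahedron_eq : octahedron = convexHull ℝ (Set.range octahedronPts) := by
  rw [octahedron]
  congr 1
  ext x
  simp [octahedronPts]
  tauto

theorem polarBody_bisimplex_eq :
    polarBody bisimplex = convexHull ℝ (Set.range bisimplexNormals) := by
  refine Set.Subset.antisymm (fun y hy => ?_) ?_
  · rw [bisimplex_eq] at hy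
    have hi : ∀ i, inner ℝ (bisimplexPts i) y ≤ 1 := fun i =>
      hy _ (subset_convexHull ℝ _ ⟨i, rfl⟩)
    have hy3 : y = !₂[y 0, y 1, y 2] := by
      ext i
      fin_cases i <;> rfl
    generalize y 0 = a at hy3
    generalize y 1 = b at hy3
    generalize y 2 = c at hy3
    subst hy3
    simp only [Fin.forall_fin_succ, bisimplexPts, Matrix.cons_val_zero, Matrix.cons_val_succ,
      inner_fin_three] at hi
    obtain ⟨h0, h1, h2, h3, h4, -⟩ := hi
    have ha : 0 ≤ 1 - a := by linarith
    have hb : 0 ≤ 1 - b := by linarith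
    have hab : 0 ≤ 1 + a + b := by linarith
    have hc : 0 ≤ 1 + c := by linarith
    have hc' : 0 ≤ 1 - c := by linarith
    -- The polar is a prism over a triangle. The weights are products of the barycentric coordinates
    -- `(1 - b) / 3`, `(1 + a + b) / 3`, `(1 - a) / 3` of the triangle with `(1 ± c) / 2` of the
    -- interval.
    have hmem := (convex_convexHull ℝ (Set.range bisimplexNormals)).sum_mem (t := Finset.univ)
      (w := ![(1 - b) * (1 + c) / 6, (1 + a + b) * (1 + c) / 6, (1 + a + b) * (1 - c) / 6,
        (1 - b) * (1 - c) / 6, (1 - a) * (1 + c) / 6, (1 - a) * (1 - c) / 6])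
      (z := bisimplexNormals) (fun i _ => by fin_cases i <;> simp <;> positivity)
      (by simp [Fin.sum_univ_succ]; ring) (fun i _ => subset_convexHull ℝ _ ⟨i, rfl⟩)
    convert hmem using 1
    ext i
    fin_cases i <;> simp [Fin.sum_univ_succ, bisimplexNormals] <;> ring
  · rw [bisimplex_eq]
    exact realizes_bisimplex.convexHull_subset_polarBody

theorem polarBody_octahedron_eq :
    polarBody octahedron = convexHull ℝ (Set.range octahedronNormals) := by
  refine Set.Subset.antisymm (fun y hy => ?_) ?_
  · rw [octahedron_eq] at hy
    have hi : ∀ i, inner ℝ (octahedronPts i) y ≤ 1 := fun i =>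
      hy _ (subset_convexHull ℝ _ ⟨i, rfl⟩)
    have hy3 : y = !₂[y 0, y 1, y 2] := by
      ext i
      fin_cases i <;> rfl
    generalize y 0 = a at hy3
    generalize y 1 = b at hy3
    generalize y 2 = c at hy3
    subst hy3
    simp only [Fin.forall_fin_succ, octahedronPts, Matrix.cons_val_zero, Matrix.cons_val_succ,
      inner_fin_three] at hi
    obtain ⟨h0, h1, h2, h3, h4, h5, -⟩ := hi
    have ha : 0 ≤ 1 - a := by linarith
    have ha' : 0 ≤ 1 + a := by linarith
    have hb : 0 ≤ 1 - b := by linarith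
    have hb' : 0 ≤ 1 + b := by linarith
    have hc : 0 ≤ 1 - c := by linarith
    have hc' : 0 ≤ 1 + c := by linarith
    -- The polar is the cube; the weights are products of `(1 ± a) / 2`, `(1 ± b) / 2`, `(1 ± c) /
    -- 2`.
    have hmem := (convex_convexHull ℝ (Set.range octahedronNormals)).sum_mem (t := Finset.univ)
      (w := ![(1 + a) * (1 - b) * (1 + c) / 8, (1 + a) * (1 + b) * (1 + c) / 8,
        (1 - a) * (1 + b) * (1 + c) / 8, (1 - a) * (1 - b) * (1 + c) / 8,
        (1 + a) * (1 - b) * (1 - c) / 8, (1 + a) * (1 + b) * (1 - c) / 8,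
        (1 - a) * (1 + b) * (1 - c) / 8, (1 - a) * (1 - b) * (1 - c) / 8])
      (z := octahedronNormals) (fun i _ => by fin_cases i <;> simp <;> positivity)
      (by simp [Fin.sum_univ_succ]; ring) (fun i _ => subset_convexHull ℝ _ ⟨i, rfl⟩)
    convert hmem using 1
    ext i
    fin_cases i <;> simp [Fin.sum_univ_succ, octahedronNormals] <;> ring
  · rw [octahedron_eq]
    exact realizes_octahedron.convexHull_subset_polarBody

/-! ### Conclusion -/

theorem HasTable.transpose {V F : Type*} {I : V → F → Prop} {m k : ℕ}
    {T : Fin m → Fin k → Bool} (h : HasTable (fun G v => I v G) T) :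
    HasTable I (fun j i => T i j) := by
  obtain ⟨i, j, h⟩ := h
  exact ⟨j, i, fun b a => h a b⟩

theorem combEquiv_of_hasTable {m n a b : ℕ} {P : Set (EuclideanSpace ℝ (Fin m))}
    {Q : Set (EuclideanSpace ℝ (Fin n))} {T : Fin a → Fin b → Bool}
    (hP : HasTable (fun (v : vertices P) (F : facets P) => v.1 ∈ F.1) T)
    (hQ : HasTable (fun (v : vertices Q) (F : facets Q) => v.1 ∈ F.1) T) : CombEquiv P Q := by
  obtain ⟨i, j, h⟩ := hP
  obtain ⟨i', j', h'⟩ := hQ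
  refine ⟨i.symm.trans i', j.symm.trans j', fun v F => ?_⟩
  have h1 := h (i.symm v) (j.symm F)
  have h2 := h' (i.symm v) (j.symm F)
  rw [i.apply_symm_apply, j.apply_symm_apply] at h1
  exact h1.trans h2.symm

/-- An infimum of natural numbers in `ℕ∞` is attained when finite: if `dim P + 1` were not among the
sizes, every size would be at least `dim P + 2`, and so would the infimum. -/
theorem IsPsdMinimal.hasPsdLift {n : ℕ} {P : Set (EuclideanSpace ℝ (Fin n))}
    (hmin : IsPsdMinimal P) : HasPsdLift (dim P + 1) P := by
  by_contra hno
  have hne : ∀ k, 1 ≤ k ∧ HasPsdLift k P → (k : ℕ∞) ≠ (dim P : ℕ∞) + 1 := by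
    rintro k ⟨-, hk⟩ heq
    have : k = dim P + 1 := by exact_mod_cast heq
    exact hno (this ▸ hk)
  have hle : ∀ k, 1 ≤ k ∧ HasPsdLift k P → (dim P : ℕ∞) + 1 ≤ k := fun k hk => by
    rw [← hmin]
    exact iInf₂_le k hk
  have h2 : ((dim P : ℕ∞) + 1) + 1 ≤ psdRank P := by
    refine le_iInf₂ fun k hk => ?_
    have h3 : dim P + 1 ≤ k := by exact_mod_cast hle k hk
    have h4 : k ≠ dim P + 1 := fun h => hne k hk (by exact_mod_cast h)
    have h5 : dim P + 1 + 1 ≤ k := by omega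
    exact_mod_cast h5
  rw [hmin] at h2
  have h6 : dim P + 1 + 1 ≤ dim P + 1 := by exact_mod_cast h2
  omega

/-- Classification of the psd-minimal polytopes of dimension three. -/
theorem combEquiv_of_isPsdMinimal {n : ℕ} (P : Set (EuclideanSpace ℝ (Fin n)))
    (hP : IsPolytope P) (hdim : dim P = 3) (hmin : IsPsdMinimal P) :
    ∃ Q ∈ ({simplex, quadPyramid, bisimplex, octahedron} : Set (Set (EuclideanSpace ℝ (Fin 3)))),
      CombEquiv P Q ∨ CombEquiv P (polarBody Q) := by
  have hlift := hmin.hasPsdLift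
  rw [hdim] at hlift
  obtain ⟨p, f, h, S, hS⟩ := isFacetSystem hP hdim
  have hfinV : Finite (vertices P) := hP.finite_vertices
  have hfinF : Finite (facets P) := by
    refine Finite.of_injective (fun F : facets P => {v : vertices P | v.1 ∈ F.1}) ?_
    exact fun F G hFG => S.ext F G fun v => Set.ext_iff.1 hFG v
  have hne : Nonempty (vertices P) := by
    by_contra hempty
    rw [not_nonempty_iff] at hempty
    have := S.span
    rw [Set.range_eq_empty, Submodule.span_empty] at this
    exact bot_ne_top this
  have hsqrt : S.polyRep.HasSqrt := hasSqrt_of_hasPsdLift hlift S.polyRep hS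
  rcases S.polyRep.classification hsqrt with h | (h | h | h) | (h | h | h)
  · refine ⟨simplex, by simp, Or.inl (combEquiv_of_hasTable h ?_)⟩
    rw [simplex_eq]
    exact realizes_simplex.hasTable isClosedTable_simplex
  · refine ⟨quadPyramid, by simp, Or.inl (combEquiv_of_hasTable h ?_)⟩
    rw [quadPyramid_eq]
    exact realizes_pyramid.hasTable isClosedTable_pyramid
  · refine ⟨bisimplex, by simp, Or.inl (combEquiv_of_hasTable h ?_)⟩
    rw [bisimplex_eq]
    exact realizes_bisimplex.hasTable isClosedTable_bisimplex
  · refine ⟨octahedron, by simp, Or.inl (combEquiv_of_hasTable h ?_)⟩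
    rw [octahedron_eq]
    exact realizes_octahedron.hasTable isClosedTable_octahedron
  · refine ⟨quadPyramid, by simp, Or.inl (combEquiv_of_hasTable h.transpose ?_)⟩
    rw [quadPyramid_eq']
    exact realizes_pyramid'.hasTable isClosedTable_pyramid_transpose
  · refine ⟨bisimplex, by simp, Or.inr (combEquiv_of_hasTable h.transpose ?_)⟩
    rw [polarBody_bisimplex_eq]
    exact realizes_bisimplex.transpose.hasTable isClosedTable_bisimplex_transpose
  · refine ⟨octahedron, by simp, Or.inr (combEquiv_of_hasTable h.transpose ?_)⟩
    rw [polarBody_octahedron_eq]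
    exact realizes_octahedron.transpose.hasTable isClosedTable_octahedron_transpose

end PsdMin

theorem proposition5p9 {n : ℕ} (P : Set (EuclideanSpace ℝ (Fin n)))
    (hP : PsdMin.IsPolytope P) (hdim : PsdMin.dim P = 3) (hmin : PsdMin.IsPsdMinimal P) :
    ∃ Q ∈ ({PsdMin.simplex, PsdMin.quadPyramid, PsdMin.bisimplex, PsdMin.octahedron} :
        Set (Set (EuclideanSpace ℝ (Fin 3)))),
      PsdMin.CombEquiv P Q ∨ PsdMin.CombEquiv P (PsdMin.polarBody Q) :=
  PsdMin.combEquiv_of_isPsdMinimal P hP hdim hmin
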